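/- Let $\mathbb T^2=\mathbb R^2/(2\pi\mathbb Z)^2$ with Lebesgue measure $dx\,dy$, and let $V\in C^\infty(\mathbb R/2\pi\mathbb Z;\mathbb R)$ satisfy $V(0)=V'(0)=0$, $V''(0)>0$ and $V(x)>0$ for $x\neq 0$. Let $\Delta_G=\partial_x^2+V(x)\partial_y^2$ be the Baouendi-Grushin operator on $\mathbb T^2$, and let $b:\mathbb T^2\to[0,\infty)$ be continuous. Assume that $\operatorname{supp}(b)\cap\{x=0\}\neq\{0\}\times\mathbb T_y$, i.e. that $\operatorname{supp} b$ does not contain the whole line $\{x=0\}$. Then the following hold. (1) There is a family $(\psi_h)_{0<h\le 1}\subset C^\infty(\mathbb T^2;\mathbb C)$ with $\|\psi_h\|_{L^2(\mathbb T^2)}=1$ such that, uniformly in $h\in(0,1]$: (a) $\|(-h^2\Delta_G+ihb-1)\psi_h\|_{L^2(\mathbb T^2)}= O(h^2)$; (b) $\|b^{1/2}\psi_h\|_{L^2(\mathbb T^2)}=O(h^\infty)$, that is, for each $N\in\mathbb N$ there is $C_N$ with $\|b^{1/2}\psi_h\|_{L^2}\le C_Nh^N$; (c) (subelliptic regime $|D_y|\sim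 h^{-2}$) there are constants $0<c_1\le c_2$ such that the part of $\psi_h$ with Fourier frequencies $n\in\mathbb Z$ in $y$ outside $c_1\le h^2|n|\le c_2$ has $L^2$ norm $O(h^\infty)$; (d) (Hermite profile) there are $y_0\in\mathbb R$ and $a\in C_c^\infty((y_0-\pi,y_0+\pi);\mathbb C)$, independent of $h$, with $(0,y)\notin\operatorname{supp} b$ for all $y\in\operatorname{supp}a$, such that, with $\omega=(V''(0)/2)^{1/2}$ and the Hermite function $\varphi_0(\eta,x)=\eta^{1/4}e^{-\eta x^2/2}$, $$\big\|\psi_h(x,y)-\varphi_0(h^{-2},x)\,a(y)\,e^{iy/(\omega h^2)}\big\|_{L^2((-\pi,\pi)\times(y_0-\pi,y_0+\pi))}=O(h).$$ (2) Consequently the resolvents are bounded below: regard $-h^2\Delta_G-1\pm ihb$ as the closed operators on $L^2(\mathbb T^2)$ obtained by closing them from $C^\infty(\mathbb T^2)$. There is $c>0$ such that, for every $h\in(0,1]$ and either sign, if $-h^2\Delta_G-1\pm ihb$ has a bounded inverse on $L^2(\mathbb T^2)$, then $$\big\|(-h^2\Delta_G-1\pm ihb)^{-1}\big\|_{\mathcal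 L(L^2)}\ge c\,h^{-2}.$$ -/

import Mathlib

open MeasureTheory Set
open scoped ENNReal ContDiff

noncomputable section

namespace Grushin

instance instFactTwoPiPos : Fact ((0 : ℝ) < 2 * Real.pi) := ⟨Real.two_pi_pos⟩

/-- The circle `ℝ / 2πℤ`; its `volume` is Lebesgue measure, of total mass `2π`. -/
abbrev Circ : Type := AddCircle (2 * Real.pi)

/-- The flat torus `𝕋² = 𝕋_x × 𝕋_y`, with Lebesgue measure `dx dy` as `volume`. -/
abbrev Torus : Type := Circ × Circ

/-- The Hilbert space `L²(𝕋²; ℂ)`. -/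
abbrev L2 : Type := Lp ℂ 2 (volume : Measure Torus)

/-- `φ ∈ C^∞(𝕋²; ℂ)`: the doubly periodic lift of `φ` to `ℝ²` is smooth. -/
def IsSmooth (φ : Torus → ℂ) : Prop :=
  ContDiff ℝ ∞ (fun q : ℝ × ℝ => φ ((q.1 : Circ), (q.2 : Circ)))

/-- The derivative `∂_x` of a function on the torus. -/
def dX (φ : Torus → ℂ) : Torus → ℂ :=
  fun p => deriv (fun t : ℝ => φ (p.1 + (t : Circ), p.2)) 0

/-- The derivative `∂_y` of a function on the torus. -/
def dY (φ : Torus → ℂ) : Torus → ℂ :=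
  fun p => deriv (fun t : ℝ => φ (p.1, p.2 + (t : Circ))) 0

/-- The admissible coefficients `V` of the Baouendi-Grushin operator: smooth and `2π`-periodic,
`V(0) = V'(0) = 0`, `V''(0) > 0`, and `V > 0` away from `x = 0`. -/
structure IsPotential (V : Circ → ℝ) : Prop where
  smooth : ContDiff ℝ ∞ (fun x : ℝ => V (x : Circ))
  zero : V 0 = 0
  deriv_zero : deriv (fun x : ℝ => V (x : Circ)) 0 = 0
  deriv2_pos : 0 < iteratedDeriv 2 (fun x : ℝ => V (x : Circ)) 0
  pos : ∀ x : Circ, x ≠ 0 → 0 < V x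

/-- The Baouendi-Grushin operator `Δ_G = ∂_x² + V(x) ∂_y²`. -/
def laplacian (V : Circ → ℝ) (φ : Torus → ℂ) : Torus → ℂ :=
  fun p => dX (dX φ) p + (V p.1 : ℂ) * dY (dY φ) p

/-- The operator `- h² Δ_G + i h b - 1` on smooth functions. -/
def dampedOp (V : Circ → ℝ) (b : Torus → ℝ) (h : ℝ) (φ : Torus → ℂ) : Torus → ℂ :=
  fun p => -(h : ℂ) ^ 2 * laplacian V φ p + Complex.I * (h : ℂ) * (b p : ℂ) * φ p - φ p

/-- The graph of `- h² Δ_G + i h b - 1` with domain `C^∞(𝕋²)`, as a subset of `L² × L²`. -/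
def opGraph (V : Circ → ℝ) (b : Torus → ℝ) (h : ℝ) : Set (L2 × L2) :=
  {q | ∃ φ : Torus → ℂ, IsSmooth φ ∧ q.1 =ᵐ[volume] φ ∧ q.2 =ᵐ[volume] dampedOp V b h φ}

/-- `R` is the inverse of the closed unbounded operator `- h² Δ_G + i h b - 1` on `L²(𝕋²)`, the
closure of the operator on `C^∞(𝕋²)`: the pair `(u, f)` lies in the closed graph exactly when
`u = R f`. -/
def IsResolvent (V : Circ → ℝ) (b : Torus → ℝ) (h : ℝ) (R : L2 →L[ℂ] L2) : Prop :=
  ∀ u f : L2, (u, f) ∈ closure (opGraph V b h) ↔ u = R f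

/-- The squared `L²` norm of the part of `φ` whose frequencies in `y` lie in `S`:
`2π ∑_{n ∈ S} ∫ |φ̂(x, n)|² dx`, with `φ̂(x, n) = (2π)⁻¹ ∫ φ(x, y) e^{-iny} dy`. -/
def yFreqMass (φ : Torus → ℂ) (S : Set ℤ) : ℝ≥0∞ :=
  ENNReal.ofReal (2 * Real.pi) *
    ∑' n : S, ∫⁻ x : Circ, ‖fourierCoeff (fun y : Circ => φ (x, y)) (n : ℤ)‖ₑ ^ 2

/-- The Hermite function `φ₀(η, x) = η^{1/4} e^{-η x² / 2}`: the ground state of the harmonic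
oscillator `- ∂_x² + η² x²`, for `η > 0`. -/
def hermiteGround (η x : ℝ) : ℝ :=
  η ^ (1 / 4 : ℝ) * Real.exp (-(η * x ^ 2) / 2)

/-- The profile `φ₀(h⁻², x) a(y) e^{i y / (w h²)}` on `ℝ²`. -/
def profile (w : ℝ) (a : ℝ → ℂ) (h : ℝ) (q : ℝ × ℝ) : ℂ :=
  (hermiteGround ((h ^ 2)⁻¹) q.1 : ℂ) * a q.2 *
    Complex.exp (Complex.I * ((q.2 / (w * h ^ 2) : ℝ) : ℂ))

end Grushin

end

/-! On functions oscillating like `e^{iy/(w h²)}`, with `w² = V''(0)/2`, the operator `-h² Δ_G`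
becomes `-h² ∂_x² + V(x)/(w² h²)` to leading order. With `x = hX` and `V = w² x² + c x³ + O(x⁴)`
this is `-∂_X² + X² + γ h X³ + O(h² X⁴)`, `γ = c / w²`: a harmonic oscillator whose ground energy is
exactly `1`. The frequency in `y` is chosen for this.

The Gaussian alone leaves the error `γ h X³`, of size `h`. Since `X³` is odd, it is orthogonal to
the ground state: first-order perturbation theory shifts no energy, and `-p'' + 2Xp' = -γ X³` has
the polynomial solution `p = -γ (X³/6 + X/2)`. The profile `(1 + h p(X)) e^{-X²/2}` then has error
`O(h²)` (`abs_oscillator_error_le`). When a `y`-derivative falls on the amplitude `a(y)`, the worst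
term is `(2i/w) V a'`. It is also `O(h²)`, because `V = O(x²)` and the Gaussian lives at `|x| ~ h`
(`sq_mul_abs_wave_le`). The two are combined in `norm_quasimode_error_le`.

As `supp b` misses a point of `{x = 0}`, it misses a box around it; cutting off in `x` and `y`
inside the box makes `b ψ_h` vanish identically, for either sign of the damping. Concentration of
the `y`-frequencies near `1/(w h²)` is repeated integration by parts on the circle
(`tsum_fourierCoeff_osc_le`). Applying the resolvent to `P ψ_h`, of norm `O(h²)`, returns `ψ_h`, of
norm `1`; this gives the lower bound. -/

namespace Grushin
open Filter Topology

/-! ### Periodization: transfer of calculus and norms from the line to the circle -/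

/-- The `2π`-periodic function on the circle that agrees with `f` on `(c - π, c + π]`. -/
noncomputable def periodize (c : ℝ) (f : ℝ → ℂ) : Circ → ℂ :=
  AddCircle.liftIoc (2 * Real.pi) (c - Real.pi) f

lemma sub_pi_add_two_pi (c : ℝ) : c - Real.pi + 2 * Real.pi = c + Real.pi := by ring

lemma periodize_coe {c : ℝ} {f : ℝ → ℂ} {x : ℝ} (hx : x ∈ Ioc (c - Real.pi) (c + Real.pi)) :
    periodize c f (x : Circ) = f x :=
  AddCircle.liftIoc_coe_apply (by rwa [sub_pi_add_two_pi])

lemma exists_mem_Ioc_coe (c : ℝ) (p : Circ) :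
    ∃ x ∈ Ioc (c - Real.pi) (c + Real.pi), (x : Circ) = p := by
  refine ⟨AddCircle.equivIoc (2 * Real.pi) (c - Real.pi) p, ?_, AddCircle.coe_equivIoc⟩
  have := (AddCircle.equivIoc (2 * Real.pi) (c - Real.pi) p).2
  exact ⟨this.1, this.2.trans_eq (sub_pi_add_two_pi c)⟩

/-- Only the seam needs an argument: at `y = c + π` the values to the right come from `f` near `c -
π`. As the support is compactly inside the open interval, `f` vanishes near both ends, and the two
branches agree. -/
lemma periodize_eventuallyEq {c : ℝ} {f : ℝ → ℂ}
    (hf : tsupport f ⊆ Ioo (c - Real.pi) (c + Real.pi)) {x y : ℝ}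
    (hy : y ∈ Ioc (c - Real.pi) (c + Real.pi)) (hxy : (y : Circ) = (x : Circ)) :
    (fun t : ℝ => periodize c f (t : Circ)) =ᶠ[𝓝 x] fun t => f (t - x + y) := by
  have key : ∀ᶠ s in 𝓝 y, periodize c f ((s : ℝ) : Circ) = f s := by
    rcases hy.2.lt_or_eq with h | h
    · filter_upwards [Ioo_mem_nhds hy.1 h] with s hs
      exact periodize_coe ⟨hs.1, hs.2.le⟩
    · have h1 : ∀ᶠ s in 𝓝 y, f s = 0 := by
        have : y ∉ tsupport f := fun hh => by have := (hf hh).2; linarith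
        exact notMem_tsupport_iff_eventuallyEq.1 this
      have h2 : ∀ᶠ s in 𝓝 y, f (s - 2 * Real.pi) = 0 := by
        have : y - 2 * Real.pi ∉ tsupport f := fun hh => by have := (hf hh).1; linarith
        have h3 := notMem_tsupport_iff_eventuallyEq.1 this
        have : Tendsto (fun s : ℝ => s - 2 * Real.pi) (𝓝 y) (𝓝 (y - 2 * Real.pi)) :=
          (continuous_id.sub continuous_const).tendsto y
        exact this.eventually h3
      have hpi := Real.pi_pos
      filter_upwards [h1, h2, Ioo_mem_nhds (a := y - Real.pi) (b := y + Real.pi) (by linarith)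
        (by linarith)] with s hs1 hs2 hs
      rcases le_or_gt s y with hsy | hsy
      · exact periodize_coe ⟨by linarith [hs.1], by linarith⟩
      · have : ((s : ℝ) : Circ) = ((s - 2 * Real.pi : ℝ) : Circ) := by
          rw [← AddCircle.coe_add_period (2 * Real.pi) (s - 2 * Real.pi)]; simp
        rw [this, periodize_coe ⟨by linarith, by linarith [hs.2]⟩, hs1, hs2]
  have ht : Tendsto (fun t : ℝ => t - x + y) (𝓝 x) (𝓝 y) := by
    have : Continuous fun t : ℝ => t - x + y := by fun_prop
    simpa using this.tendsto x
  filter_upwards [ht.eventually key] with t ht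
  rw [← ht]
  congr 1
  change _ = ((t - x + y : ℝ) : Circ)
  rw [AddCircle.coe_add, AddCircle.coe_sub, hxy, sub_add_cancel]

lemma contDiff_periodize {c : ℝ} {f : ℝ → ℂ} (hs : ContDiff ℝ ∞ f)
    (hf : tsupport f ⊆ Ioo (c - Real.pi) (c + Real.pi)) :
    ContDiff ℝ ∞ (fun t : ℝ => periodize c f (t : Circ)) := by
  rw [contDiff_iff_contDiffAt]
  intro x
  obtain ⟨y, hy, hxy⟩ := exists_mem_Ioc_coe c (x : Circ)
  refine ContDiffAt.congr_of_eventuallyEq ?_ (periodize_eventuallyEq hf hy hxy)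
  exact (hs.comp (by fun_prop : ContDiff ℝ ∞ fun t : ℝ => t - x + y)).contDiffAt

/-- `F'` is the derivative of the function `F` on the circle. -/
def HasCircDeriv (F F' : Circ → ℂ) : Prop :=
  ∀ x : ℝ, HasDerivAt (fun t : ℝ => F (t : Circ)) (F' (x : Circ)) x

lemma hasCircDeriv_periodize {c : ℝ} {f f' : ℝ → ℂ} (hd : ∀ x, HasDerivAt f (f' x) x)
    (hf : tsupport f ⊆ Ioo (c - Real.pi) (c + Real.pi)) :
    HasCircDeriv (periodize c f) (periodize c f') := by
  intro x
  obtain ⟨y, hy, hxy⟩ := exists_mem_Ioc_coe c (x : Circ)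
  refine HasDerivAt.congr_of_eventuallyEq ?_ (periodize_eventuallyEq hf hy hxy)
  rw [← hxy, periodize_coe hy]
  have h1 : HasDerivAt f (f' y) (x - x + y) := by simpa using hd y
  have h2 : HasDerivAt (fun t : ℝ => t - x + y) 1 x := by
    simpa using ((hasDerivAt_id x).sub_const x).add_const y
  simpa [Function.comp_def] using h1.scomp x h2

lemma continuous_of_lift {E : Type*} [TopologicalSpace E] {F : Circ → E}
    (h : Continuous fun t : ℝ => F (t : Circ)) : Continuous F :=
  continuous_coinduced_dom.2 h

lemma continuous_periodize {c : ℝ} {f : ℝ → ℂ} (hs : ContDiff ℝ ∞ f)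
    (hf : tsupport f ⊆ Ioo (c - Real.pi) (c + Real.pi)) : Continuous (periodize c f) :=
  continuous_of_lift (contDiff_periodize hs hf).continuous

lemma HasCircDeriv.shift {F F' : Circ → ℂ} (h : HasCircDeriv F F') (p : Circ) :
    HasDerivAt (fun t : ℝ => F (p + (t : Circ))) (F' p) 0 := by
  obtain ⟨x, -, rfl⟩ := exists_mem_Ioc_coe 0 p
  have h1 : HasDerivAt (fun t : ℝ => F (t : Circ)) (F' (x : Circ)) (x + 0) := by
    simpa using h x
  have h2 : HasDerivAt (fun t : ℝ => x + t) 1 0 := (hasDerivAt_id (0 : ℝ)).const_add x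
  simpa [Function.comp_def] using h1.scomp 0 h2

lemma dX_mul {F F' : Circ → ℂ} (h : HasCircDeriv F F') (G : Circ → ℂ) :
    dX (fun p => F p.1 * G p.2) = fun p => F' p.1 * G p.2 := by
  funext p
  exact ((h.shift p.1).mul_const (G p.2)).deriv

lemma dY_mul {G G' : Circ → ℂ} (h : HasCircDeriv G G') (F : Circ → ℂ) :
    dY (fun p => F p.1 * G p.2) = fun p => F p.1 * G' p.2 := by
  funext p
  exact ((h.shift p.2).const_mul (F p.1)).deriv

lemma eLpNorm_periodize (c : ℝ) {f : ℝ → ℂ} (hf : AEStronglyMeasurable f volume) (p : ℝ≥0∞) :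
    eLpNorm (periodize c f) p volume
      = eLpNorm f p (volume.restrict (Ioc (c - Real.pi) (c + Real.pi))) := by
  have h : MeasurePreserving
      (fun z : Circ => (AddCircle.equivIoc (2 * Real.pi) (c - Real.pi) z : ℝ)) volume
      (volume.restrict (Ioc (c - Real.pi) (c - Real.pi + 2 * Real.pi))) :=
    (measurePreserving_subtype_coe measurableSet_Ioc).comp
      (AddCircle.measurePreserving_equivIoc (2 * Real.pi))
  have := eLpNorm_comp_measurePreserving (p := p) hf.restrict h
  exact this.trans (by rw [sub_pi_add_two_pi])

lemma eLpNorm_periodize_of_support {c : ℝ} {f : ℝ → ℂ} (hf : Continuous f)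
    (hs : tsupport f ⊆ Ioo (c - Real.pi) (c + Real.pi)) (p : ℝ≥0∞) :
    eLpNorm (periodize c f) p volume = eLpNorm f p volume := by
  rw [eLpNorm_periodize c hf.aestronglyMeasurable]
  exact eLpNorm_restrict_eq_of_support_subset
    ((subset_tsupport f).trans (hs.trans Ioo_subset_Ioc_self))

lemma eLpNorm_mul_prod {α β : Type*} [MeasurableSpace α] [MeasurableSpace β] {μ : Measure α}
    {ν : Measure β} [SFinite μ] [SFinite ν] {F : α → ℂ} {G : β → ℂ}
    (hF : AEStronglyMeasurable F μ) (hG : AEStronglyMeasurable G ν) :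
    eLpNorm (fun p : α × β => F p.1 * G p.2) 2 (μ.prod ν) = eLpNorm F 2 μ * eLpNorm G 2 ν := by
  simp only [eLpNorm_eq_lintegral_rpow_enorm_toReal (p := 2) two_ne_zero ENNReal.ofNat_ne_top,
    enorm_mul]
  rw [← ENNReal.mul_rpow_of_nonneg _ _ (by positivity)]
  congr 1
  rw [← lintegral_prod_mul (hF.enorm.pow_const _) (hG.enorm.pow_const _)]
  congr 1
  funext p
  rw [ENNReal.mul_rpow_of_nonneg _ _ (by positivity)]

/-! ### Fourier coefficients -/

/-- Integration by parts over one period; the boundary terms cancel by periodicity. -/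
lemma fourierCoeff_of_hasCircDeriv {F F' : Circ → ℂ} (h : HasCircDeriv F F')
    (hF' : Continuous F') (n : ℤ) :
    fourierCoeff F' n = Complex.I * n * fourierCoeff F n := by
  have hF : Continuous F := continuous_of_lift
    (continuous_iff_continuousAt.2 fun x => (h x).continuousAt)
  have hT : ((2 * Real.pi : ℝ) : ℂ) ≠ 0 := by exact_mod_cast Real.two_pi_pos.ne'
  have hd : ∀ x : ℝ, HasDerivAt (fun t : ℝ => fourier (-n) (t : Circ) * F (t : Circ))
      (fourier (-n) (x : Circ) * F' (x : Circ)
        - Complex.I * n * (fourier (-n) (x : Circ) * F (x : Circ))) x := by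
    intro x
    have := (hasDerivAt_fourier_neg (2 * Real.pi) n x).mul (h x)
    refine this.congr_deriv ?_
    have hp : (Real.pi : ℂ) ≠ 0 := by exact_mod_cast Real.pi_ne_zero
    push_cast
    field_simp
    ring
  have hc1 : Continuous fun t : ℝ => fourier (-n) (t : Circ) * F' (t : Circ) :=
    ((fourier (-n)).continuous.mul hF').comp continuous_quotient_mk'
  have hc2 : Continuous fun t : ℝ => fourier (-n) (t : Circ) * F (t : Circ) :=
    ((fourier (-n)).continuous.mul hF).comp continuous_quotient_mk'
  have hc3 : Continuous fun t : ℝ => Complex.I * n * (fourier (-n) (t : Circ) * F (t : Circ)) :=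
    continuous_const.mul hc2
  have hi := intervalIntegral.integral_eq_sub_of_hasDerivAt (a := 0) (b := 0 + 2 * Real.pi)
    (fun x _ => hd x) ((hc1.sub hc3).intervalIntegrable _ _)
  rw [AddCircle.coe_add_period, sub_self, intervalIntegral.integral_sub
    (hc1.intervalIntegrable _ _) (hc3.intervalIntegrable _ _),
    intervalIntegral.integral_const_mul, sub_eq_zero] at hi
  rw [fourierCoeff_eq_intervalIntegral F' n 0, fourierCoeff_eq_intervalIntegral F n 0]
  simp only [smul_eq_mul]
  rw [hi, mul_smul_comm]

/-- Parseval. Fourier coefficients use Haar measure of total mass `1`, so no factor `2π` appears. -/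
lemma tsum_enorm_sq_fourierCoeff_le {F : Circ → ℂ} (hF : Continuous F) {M : ℝ}
    (hM : ∀ z, ‖F z‖ ≤ M) :
    ∑' n : ℤ, ‖fourierCoeff F n‖ₑ ^ 2 ≤ ENNReal.ofReal (M ^ 2) := by
  have hm : MemLp F 2 (AddCircle.haarAddCircle (T := 2 * Real.pi)) :=
    .of_bound hF.aestronglyMeasurable M (ae_of_all _ hM)
  have h := hasSum_sq_fourierCoeff hm.toLp
  have h2 : ∀ n : ℤ, ‖fourierCoeff F n‖ₑ ^ 2
      = ENNReal.ofReal (‖fourierCoeff (hm.toLp : Circ → ℂ) n‖ ^ 2) := fun n => by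
    rw [fourierCoeff_congr_ae hm.coeFn_toLp, ENNReal.ofReal_pow (norm_nonneg _), ofReal_norm]
  simp_rw [h2]
  rw [← ENNReal.ofReal_tsum_of_nonneg (fun n => by positivity) h.summable, h.tsum_eq]
  refine ENNReal.ofReal_le_ofReal ?_
  have hae : (fun t => ‖(hm.toLp : Circ → ℂ) t‖ ^ 2) ≤ᵐ[AddCircle.haarAddCircle]
      fun _ => M ^ 2 := by
    filter_upwards [hm.coeFn_toLp] with t ht
    rw [ht]
    exact pow_le_pow_left₀ (norm_nonneg _) (hM t) 2
  have := integral_mono_of_nonneg (Eventually.of_forall fun t => by positivity)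
    (integrable_const (M ^ 2)) hae
  simpa using this

lemma measurable_periodize (c : ℝ) {f : ℝ → ℂ} (hf : Measurable f) :
    Measurable (periodize c f) :=
  hf.comp (measurable_subtype_coe.comp
    (AddCircle.measurableEquivIoc (2 * Real.pi) (c - Real.pi)).measurable)

lemma norm_periodize_le {c M : ℝ} {f : ℝ → ℂ} (hM : ∀ x, ‖f x‖ ≤ M) (z : Circ) :
    ‖periodize c f z‖ ≤ M := by
  obtain ⟨x, hx, rfl⟩ := exists_mem_Ioc_coe c z
  rw [periodize_coe hx]
  exact hM x

/-! ### Tensor products -/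

lemma continuous_of_isPotential {V : Circ → ℝ} (hV : IsPotential V) : Continuous V :=
  continuous_of_lift hV.smooth.continuous

lemma contDiff_deriv {f : ℝ → ℂ} (hf : ContDiff ℝ ∞ f) : ContDiff ℝ ∞ (deriv f) :=
  (contDiff_infty_iff_deriv.1 hf).2

lemma hasCircDeriv_periodize_deriv {c : ℝ} {f : ℝ → ℂ} (hs : ContDiff ℝ ∞ f)
    (hf : tsupport f ⊆ Ioo (c - Real.pi) (c + Real.pi)) :
    HasCircDeriv (periodize c f) (periodize c (deriv f)) :=
  hasCircDeriv_periodize (fun x => (hs.differentiable (by simp) x).hasDerivAt) hf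

lemma isSmooth_tensor {x₀ y₀ : ℝ} {f g : ℝ → ℂ} (hf : ContDiff ℝ ∞ f)
    (hfs : tsupport f ⊆ Ioo (x₀ - Real.pi) (x₀ + Real.pi)) (hg : ContDiff ℝ ∞ g)
    (hgs : tsupport g ⊆ Ioo (y₀ - Real.pi) (y₀ + Real.pi)) :
    IsSmooth fun p => periodize x₀ f p.1 * periodize y₀ g p.2 :=
  ((contDiff_periodize hf hfs).comp contDiff_fst).mul
    ((contDiff_periodize hg hgs).comp contDiff_snd)

/-- The damping disappears because `b` vanishes wherever the product does not; what is left
separates into one-variable derivatives. -/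
lemma dampedOp_tensor {V : Circ → ℝ} {b : Torus → ℝ} {h x₀ y₀ : ℝ} {f g : ℝ → ℂ}
    (hf : ContDiff ℝ ∞ f) (hfs : tsupport f ⊆ Ioo (x₀ - Real.pi) (x₀ + Real.pi))
    (hg : ContDiff ℝ ∞ g) (hgs : tsupport g ⊆ Ioo (y₀ - Real.pi) (y₀ + Real.pi))
    (hb : ∀ p : Torus, periodize x₀ f p.1 * periodize y₀ g p.2 ≠ 0 → b p = 0) :
    dampedOp V b h (fun p => periodize x₀ f p.1 * periodize y₀ g p.2) = fun p =>
      -(h : ℂ) ^ 2 * (periodize x₀ (deriv (deriv f)) p.1 * periodize y₀ g p.2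
        + V p.1 * (periodize x₀ f p.1 * periodize y₀ (deriv (deriv g)) p.2))
      - periodize x₀ f p.1 * periodize y₀ g p.2 := by
  funext p
  have h0 : Complex.I * (h : ℂ) * (b p : ℂ) * (periodize x₀ f p.1 * periodize y₀ g p.2) = 0 := by
    by_cases hp : periodize x₀ f p.1 * periodize y₀ g p.2 = 0
    · rw [hp, mul_zero]
    · rw [hb p hp]; simp
  simp only [dampedOp, laplacian]
  rw [h0, dX_mul (hasCircDeriv_periodize_deriv hf hfs),
    dX_mul (hasCircDeriv_periodize_deriv (contDiff_deriv hf) (tsupport_deriv_subset.trans hfs)),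
    dY_mul (hasCircDeriv_periodize_deriv hg hgs),
    dY_mul (hasCircDeriv_periodize_deriv (contDiff_deriv hg) (tsupport_deriv_subset.trans hgs)),
    add_zero]

lemma continuous_dampedOp_tensor {V : Circ → ℝ} {b : Torus → ℝ} {h x₀ y₀ : ℝ} {f g : ℝ → ℂ}
    (hV : Continuous V)
    (hf : ContDiff ℝ ∞ f) (hfs : tsupport f ⊆ Ioo (x₀ - Real.pi) (x₀ + Real.pi))
    (hg : ContDiff ℝ ∞ g) (hgs : tsupport g ⊆ Ioo (y₀ - Real.pi) (y₀ + Real.pi))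
    (hb : ∀ p : Torus, periodize x₀ f p.1 * periodize y₀ g p.2 ≠ 0 → b p = 0) :
    Continuous (dampedOp V b h (fun p => periodize x₀ f p.1 * periodize y₀ g p.2)) := by
  rw [dampedOp_tensor hf hfs hg hgs hb]
  have c1 := continuous_periodize hf hfs
  have c2 := continuous_periodize hg hgs
  have c3 := continuous_periodize (contDiff_deriv (contDiff_deriv hf))
    (tsupport_deriv_subset.trans (tsupport_deriv_subset.trans hfs))
  have c4 := continuous_periodize (contDiff_deriv (contDiff_deriv hg))
    (tsupport_deriv_subset.trans (tsupport_deriv_subset.trans hgs))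
  fun_prop

/-! ### Oscillating functions of `y` -/

/-- The function `f(y) e^{i y / μ}`. -/
noncomputable def osc (μ : ℝ) (f : ℝ → ℂ) (y : ℝ) : ℂ :=
  f y * Complex.exp (Complex.I * ((y / μ : ℝ) : ℂ))

lemma norm_osc (μ : ℝ) (f : ℝ → ℂ) (y : ℝ) : ‖osc μ f y‖ = ‖f y‖ := by
  rw [osc, norm_mul, mul_comm Complex.I, Complex.norm_exp_ofReal_mul_I, mul_one]

lemma contDiff_osc (μ : ℝ) {f : ℝ → ℂ} (hf : ContDiff ℝ ∞ f) : ContDiff ℝ ∞ (osc μ f) := by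
  have h1 : ContDiff ℝ ∞ fun y : ℝ => ((y / μ : ℝ) : ℂ) :=
    Complex.ofRealCLM.contDiff.comp (contDiff_id.div_const μ)
  exact hf.mul (contDiff_const.mul h1).cexp

lemma tsupport_osc_subset (μ : ℝ) (f : ℝ → ℂ) : tsupport (osc μ f) ⊆ tsupport f :=
  tsupport_mul_subset_left

lemma deriv_osc (μ : ℝ) {f : ℝ → ℂ} (hf : ContDiff ℝ ∞ f) :
    deriv (osc μ f) = osc μ (fun y => deriv f y + Complex.I * (μ : ℂ)⁻¹ * f y) := by
  funext y
  have h1 : HasDerivAt (fun y : ℝ => ((y / μ : ℝ) : ℂ)) ((1 / μ : ℝ) : ℂ) y :=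
    ((hasDerivAt_id y).div_const μ).ofReal_comp
  have h2 := ((hf.differentiable (by simp) y).hasDerivAt).mul (h1.const_mul Complex.I).cexp
  refine h2.deriv.trans ?_
  simp only [osc]
  push_cast
  ring

lemma deriv_deriv_osc (μ : ℝ) {f : ℝ → ℂ} (hf : ContDiff ℝ ∞ f) :
    deriv (deriv (osc μ f)) = osc μ (fun y => deriv (deriv f) y
      + 2 * Complex.I * (μ : ℂ)⁻¹ * deriv f y - (μ : ℂ)⁻¹ ^ 2 * f y) := by
  have hf' := contDiff_deriv hf
  have hd : ∀ y, deriv (fun y => deriv f y + Complex.I * (μ : ℂ)⁻¹ * f y) y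
      = deriv (deriv f) y + Complex.I * (μ : ℂ)⁻¹ * deriv f y := fun y =>
    (((hf'.differentiable (by simp) y).hasDerivAt).add
      (((hf.differentiable (by simp) y).hasDerivAt).const_mul _)).deriv
  rw [deriv_osc μ hf, deriv_osc μ (hf'.add (contDiff_const.mul hf))]
  congr 1
  funext y
  rw [hd]
  linear_combination (μ : ℂ)⁻¹ ^ 2 * f y * Complex.I_sq

/-- Each derivative on the amplitude gains the distance from `n` to the frequency `μ⁻¹`. That
frequency need not be an integer: the amplitude is supported inside one period, so the oscillating
function still periodizes smoothly. -/
lemma fourierCoeff_osc_deriv {y₀ : ℝ} (μ : ℝ) {f : ℝ → ℂ} (hf : ContDiff ℝ ∞ f)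
    (hfs : tsupport f ⊆ Ioo (y₀ - Real.pi) (y₀ + Real.pi)) (n : ℤ) :
    fourierCoeff (periodize y₀ (osc μ (deriv f))) n
      = Complex.I * (n - (μ : ℂ)⁻¹) * fourierCoeff (periodize y₀ (osc μ f)) n := by
  have hg := contDiff_osc μ hf
  have hgs := (tsupport_osc_subset μ f).trans hfs
  have h1 := fourierCoeff_of_hasCircDeriv (hasCircDeriv_periodize_deriv hg hgs)
    (continuous_periodize (contDiff_deriv hg) (tsupport_deriv_subset.trans hgs)) n
  have h2 : periodize y₀ (deriv (osc μ f))
      = periodize y₀ (osc μ (deriv f)) + (Complex.I * (μ : ℂ)⁻¹) • periodize y₀ (osc μ f) := by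
    funext z
    obtain ⟨y, hy, rfl⟩ := exists_mem_Ioc_coe y₀ z
    simp only [Pi.add_apply, Pi.smul_apply, periodize_coe hy, deriv_osc μ hf, osc, smul_eq_mul]
    ring
  have c1 := continuous_periodize (contDiff_osc μ (contDiff_deriv hf))
    ((tsupport_osc_subset μ _).trans (tsupport_deriv_subset.trans hfs))
  have c2 := continuous_periodize hg hgs
  have hI : ∀ {F : Circ → ℂ}, Continuous F → Integrable F AddCircle.haarAddCircle := fun hF =>
    hF.integrable_of_hasCompactSupport (HasCompactSupport.of_compactSpace _)
  rw [h2, fourierCoeff.add (hI c1) ((hI c2).smul _), Pi.add_apply, fourierCoeff.const_smul,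
    smul_eq_mul] at h1
  linear_combination h1

lemma contDiff_iteratedDeriv {f : ℝ → ℂ} (hf : ContDiff ℝ ∞ f) (N : ℕ) :
    ContDiff ℝ ∞ (iteratedDeriv N f) := by
  induction N with
  | zero => simpa
  | succ N ih => rw [iteratedDeriv_succ]; exact contDiff_deriv ih

lemma tsupport_iteratedDeriv_subset (f : ℝ → ℂ) (N : ℕ) :
    tsupport (iteratedDeriv N f) ⊆ tsupport f := by
  induction N with
  | zero => simp
  | succ N ih => rw [iteratedDeriv_succ]; exact tsupport_deriv_subset.trans ih

lemma norm_fourierCoeff_osc_iteratedDeriv {y₀ : ℝ} (μ : ℝ) {f : ℝ → ℂ} (hf : ContDiff ℝ ∞ f)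
    (hfs : tsupport f ⊆ Ioo (y₀ - Real.pi) (y₀ + Real.pi)) (n : ℤ) (N : ℕ) :
    ‖fourierCoeff (periodize y₀ (osc μ (iteratedDeriv N f))) n‖
      = |(n : ℝ) - μ⁻¹| ^ N * ‖fourierCoeff (periodize y₀ (osc μ f)) n‖ := by
  induction N with
  | zero => simp
  | succ N ih =>
    rw [iteratedDeriv_succ, fourierCoeff_osc_deriv μ (contDiff_iteratedDeriv hf N)
      ((tsupport_iteratedDeriv_subset f N).trans hfs), norm_mul, norm_mul, Complex.norm_I, ih]
    have : ‖(n : ℂ) - (μ : ℂ)⁻¹‖ = |(n : ℝ) - μ⁻¹| := by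
      rw [← Real.norm_eq_abs, ← Complex.norm_real]; push_cast; rfl
    rw [this]
    ring

lemma exists_norm_le_of_tsupport {c : ℝ} {f : ℝ → ℂ} (hf : Continuous f)
    (hfs : tsupport f ⊆ Ioo (c - Real.pi) (c + Real.pi)) : ∃ M, 0 ≤ M ∧ ∀ x, ‖f x‖ ≤ M := by
  have hc : HasCompactSupport f := HasCompactSupport.intro
    (isCompact_Icc (a := c - Real.pi) (b := c + Real.pi)) fun x hx => by
      by_contra h
      exact hx (Ioo_subset_Icc_self (hfs (subset_tsupport f h)))
  obtain ⟨M, hM⟩ := hc.exists_bound_of_continuous hf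
  exact ⟨M, (norm_nonneg _).trans (hM 0), hM⟩

/-- Fourier coefficients of an oscillating function away from its frequency. -/
lemma tsum_fourierCoeff_osc_le {y₀ : ℝ} {f : ℝ → ℂ} (hf : ContDiff ℝ ∞ f)
    (hfs : tsupport f ⊆ Ioo (y₀ - Real.pi) (y₀ + Real.pi)) (N : ℕ) :
    ∃ M : ℝ, ∀ (μ r : ℝ) (S : Set ℤ), 0 < r → (∀ n ∈ S, r⁻¹ ≤ |(n : ℝ) - μ⁻¹|) →
      ∑' n : S, ‖fourierCoeff (periodize y₀ (osc μ f)) (n : ℤ)‖ₑ ^ 2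
        ≤ ENNReal.ofReal (M ^ 2 * r ^ (2 * N)) := by
  have hN := contDiff_iteratedDeriv hf N
  have hNs := (tsupport_iteratedDeriv_subset f N).trans hfs
  obtain ⟨M, -, hM⟩ := exists_norm_le_of_tsupport hN.continuous hNs
  refine ⟨M, fun μ r S hr hS => ?_⟩
  have h1 := tsum_enorm_sq_fourierCoeff_le (continuous_periodize (contDiff_osc μ hN)
    ((tsupport_osc_subset μ _).trans hNs)) (M := M)
    (norm_periodize_le fun y => (norm_osc μ _ y).trans_le (hM y))
  have h2 : ∀ n : S, ‖fourierCoeff (periodize y₀ (osc μ f)) (n : ℤ)‖ₑ ^ 2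
      ≤ ENNReal.ofReal (r ^ (2 * N))
        * ‖fourierCoeff (periodize y₀ (osc μ (iteratedDeriv N f))) (n : ℤ)‖ₑ ^ 2 := by
    intro n
    rw [← ofReal_norm, ← ofReal_norm, ← ENNReal.ofReal_pow (norm_nonneg _),
      ← ENNReal.ofReal_pow (norm_nonneg _), ← ENNReal.ofReal_mul (by positivity),
      norm_fourierCoeff_osc_iteratedDeriv μ hf hfs]
    refine ENNReal.ofReal_le_ofReal ?_
    -- On `S` the distance to `μ⁻¹` is at least `r⁻¹`, so inserting `2N` factors `r |n - μ⁻¹| ≥ 1`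
    -- only increases the term, and turns it into a coefficient of the `N`-th derivative.
    have h3 : 1 ≤ r * |((n : ℤ) : ℝ) - μ⁻¹| := by
      have := mul_le_mul_of_nonneg_left (hS n n.2) hr.le
      rwa [mul_inv_cancel₀ hr.ne'] at this
    calc ‖fourierCoeff (periodize y₀ (osc μ f)) (n : ℤ)‖ ^ 2
        ≤ (r * |((n : ℤ) : ℝ) - μ⁻¹|) ^ (2 * N)
          * ‖fourierCoeff (periodize y₀ (osc μ f)) (n : ℤ)‖ ^ 2 :=
          le_mul_of_one_le_left (by positivity) (one_le_pow₀ h3)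
      _ = _ := by ring
  refine (ENNReal.tsum_le_tsum h2).trans ?_
  rw [ENNReal.tsum_mul_left, mul_comm (M ^ 2), ENNReal.ofReal_mul (by positivity)]
  gcongr
  exact (ENNReal.tsum_comp_le_tsum_of_injective Subtype.val_injective _).trans h1

/-! ### Taylor expansion on `[-R, R]` -/

lemma abs_le_mul_pow_succ {R M : ℝ} {n : ℕ} {g g' : ℝ → ℝ} (hg : ∀ x, HasDerivAt g (g' x) x)
    (h0 : g 0 = 0) (hM : ∀ x, |x| ≤ R → |g' x| ≤ M * |x| ^ n) {x : ℝ} (hx : |x| ≤ R) :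
    |g x| ≤ M * |x| ^ (n + 1) := by
  have hM0 : 0 ≤ M * |x| ^ n := (abs_nonneg _).trans (hM x hx)
  have hb : ∀ t ∈ uIcc 0 x, ‖g' t‖ ≤ M * |x| ^ n := by
    intro t ht
    have htx : |t| ≤ |x| := by simpa using abs_sub_left_of_mem_uIcc ht
    refine (hM t (htx.trans hx)).trans ?_
    -- The sign of `M` is not assumed. If `M < 0`, the bound at `t` is at most `0`, while the bound
    -- at `x` is nonnegative.
    by_cases hM' : 0 ≤ M
    · gcongr
    · have h1 := hM t (htx.trans hx)
      have h2 : M * |t| ^ n ≤ 0 := mul_nonpos_of_nonpos_of_nonneg (by linarith) (by positivity)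
      linarith
  have := (convex_uIcc (0 : ℝ) x).norm_image_sub_le_of_norm_hasDerivWithin_le
    (fun t _ => (hg t).hasDerivWithinAt) hb left_mem_uIcc right_mem_uIcc
  simpa [h0, pow_succ, mul_assoc] using this

/-- Induction by integrating: the remainder of `f` vanishes at `0` and its derivative is the
remainder of `f'` of one order less. The constant is unchanged at each step. -/
lemma exists_taylor_bound (R : ℝ) (n : ℕ) : ∀ f : ℝ → ℝ, ContDiff ℝ ∞ f → ∃ C, 0 ≤ C ∧
    ∀ x, |x| ≤ R → |f x - ∑ k ∈ Finset.range n, iteratedDeriv k f 0 / k.factorial * x ^ k|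
      ≤ C * |x| ^ n := by
  induction n with
  | zero =>
    intro f hf
    obtain ⟨C, hC⟩ := isCompact_Icc.exists_bound_of_continuousOn (s := Icc (-R) R)
      hf.continuous.continuousOn
    refine ⟨max C 0, le_max_right _ _, fun x hx => ?_⟩
    simpa using Or.inl (hC x (abs_le.1 hx))
  | succ n ih =>
    intro f hf
    have hf' : ContDiff ℝ ∞ (deriv f) := (contDiff_infty_iff_deriv.1 hf).2
    obtain ⟨C, hC0, hC⟩ := ih (deriv f) hf'
    refine ⟨C, hC0, fun x hx => ?_⟩
    refine abs_le_mul_pow_succ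
      (g := fun x => f x - ∑ k ∈ Finset.range (n + 1), iteratedDeriv k f 0 / k.factorial * x ^ k)
      (g' := fun x => deriv f x
        - ∑ k ∈ Finset.range n, iteratedDeriv k (deriv f) 0 / k.factorial * x ^ k)
      (fun x => ?_) (by simp [Finset.sum_range_succ']) hC hx
    refine ((hf.differentiable (by simp)) x).hasDerivAt.sub ?_
    have : ∀ k ∈ Finset.range (n + 1), HasDerivAt
        (fun x : ℝ => iteratedDeriv k f 0 / k.factorial * x ^ k)
        (iteratedDeriv k f 0 / k.factorial * (k * x ^ (k - 1))) x :=
      fun k _ => (hasDerivAt_pow k x).const_mul _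
    refine (HasDerivAt.fun_sum this).congr_deriv ?_
    rw [Finset.sum_range_succ']
    simp only [Nat.cast_zero, zero_mul, mul_zero, add_zero]
    refine Finset.sum_congr rfl fun k _ => ?_
    rw [iteratedDeriv_succ', Nat.factorial_succ, Nat.add_sub_cancel]
    have : (k.factorial : ℝ) ≠ 0 := by positivity
    push_cast
    field_simp

/-! ### The perturbed Hermite function -/

/-- The amplitude `1 + h p(X)`, with `p` the solution of `-p'' + 2 X p' = -γ X³` that corrects the
harmonic ground state for a cubic perturbation of the potential. -/
noncomputable def amp (γ h X : ℝ) : ℝ := 1 + h * (-γ * (X ^ 3 / 6 + X / 2))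

/-- The corrected ground state at scale `h`. -/
noncomputable def wave (γ h x : ℝ) : ℝ := amp γ h (x / h) * Real.exp (-(x / h) ^ 2 / 2)

noncomputable def wave' (γ h x : ℝ) : ℝ :=
  h⁻¹ * ((h * (-γ * ((x / h) ^ 2 / 2 + 1 / 2)) - (x / h) * amp γ h (x / h))
    * Real.exp (-(x / h) ^ 2 / 2))

noncomputable def wave'' (γ h x : ℝ) : ℝ :=
  h⁻¹ ^ 2 * ((h * (-γ * (x / h)) - 2 * (x / h) * (h * (-γ * ((x / h) ^ 2 / 2 + 1 / 2)))
    + ((x / h) ^ 2 - 1) * amp γ h (x / h)) * Real.exp (-(x / h) ^ 2 / 2))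

lemma hasDerivAt_amp (γ h X : ℝ) :
    HasDerivAt (amp γ h) (h * (-γ * (X ^ 2 / 2 + 1 / 2))) X := by
  have := (((((hasDerivAt_pow 3 X).div_const 6).add ((hasDerivAt_id X).div_const 2)).const_mul
    (-γ)).const_mul h).const_add 1
  refine this.congr_deriv ?_
  norm_num
  ring_nf
  simp

lemma hasDerivAt_gauss (X : ℝ) : HasDerivAt (fun X : ℝ => Real.exp (-X ^ 2 / 2))
    (-X * Real.exp (-X ^ 2 / 2)) X := by
  have := (((hasDerivAt_pow 2 X).neg).div_const 2).exp
  refine this.congr_deriv ?_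
  simp
  ring

lemma hasDerivAt_wave (γ h x : ℝ) : HasDerivAt (wave γ h) (wave' γ h x) x := by
  have h1 := (hasDerivAt_amp γ h (x / h)).mul (hasDerivAt_gauss (x / h))
  have h2 : HasDerivAt (fun x : ℝ => x / h) (1 / h) x := (hasDerivAt_id x).div_const h
  refine (h1.comp x h2).congr_deriv ?_
  simp only [wave', amp]
  ring

lemma hasDerivAt_wave' (γ h x : ℝ) : HasDerivAt (wave' γ h) (wave'' γ h x) x := by
  have h0 : HasDerivAt (fun X : ℝ => h * (-γ * (X ^ 2 / 2 + 1 / 2))) (h * (-γ * (x / h)))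
      (x / h) := by
    have := (((((hasDerivAt_pow 2 (x / h)).div_const 2)).add_const (1 / 2)).const_mul
      (-γ)).const_mul h
    refine this.congr_deriv ?_
    simp
  have h1 := (((h0.sub ((hasDerivAt_id (x / h)).mul (hasDerivAt_amp γ h (x / h)))).mul
    (hasDerivAt_gauss (x / h)))).const_mul h⁻¹
  have h2 : HasDerivAt (fun x : ℝ => x / h) (1 / h) x := (hasDerivAt_id x).div_const h
  refine (h1.comp x h2).congr_deriv ?_
  simp only [wave'', amp, id, Pi.sub_apply, Pi.mul_apply]
  ring

lemma contDiff_wave (γ h : ℝ) : ContDiff ℝ ∞ (wave γ h) := by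
  unfold wave amp
  fun_prop

/-! ### Pointwise Gaussian bounds -/

/-- Half of the Gaussian decay is spent on absorbing polynomial factors; every error below carries
at most `(1 + X²)⁴`. -/
lemma poly_mul_gauss_le (X : ℝ) :
    (1 + X ^ 2) ^ 4 * Real.exp (-X ^ 2 / 2) ≤ 16 ^ 4 * Real.exp (-X ^ 2 / 4) := by
  have h1 : 1 + X ^ 2 ≤ 16 * Real.exp (X ^ 2 / 16) := by
    have := Real.add_one_le_exp (X ^ 2 / 16)
    linarith
  have h2 : (1 + X ^ 2) ^ 4 ≤ 16 ^ 4 * Real.exp (X ^ 2 / 4) := by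
    calc (1 + X ^ 2) ^ 4 ≤ (16 * Real.exp (X ^ 2 / 16)) ^ 4 := by gcongr
      _ = 16 ^ 4 * Real.exp (X ^ 2 / 4) := by
        rw [mul_pow, ← Real.exp_nat_mul]; congr 2; push_cast; ring
  calc (1 + X ^ 2) ^ 4 * Real.exp (-X ^ 2 / 2)
      ≤ 16 ^ 4 * Real.exp (X ^ 2 / 4) * Real.exp (-X ^ 2 / 2) := by gcongr
    _ = 16 ^ 4 * Real.exp (-X ^ 2 / 4) := by
      rw [mul_assoc, ← Real.exp_add]; congr 2; ring

section bounds

variable {γ h X : ℝ}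

lemma abs_le_one_add_sq (X : ℝ) : |X| ≤ 1 + X ^ 2 := by
  rw [← sq_abs]; nlinarith [sq_nonneg (|X| - 1), abs_nonneg X]

lemma abs_corrector_le (γ X : ℝ) : |-γ * (X ^ 3 / 6 + X / 2)| ≤ |γ| * (1 + X ^ 2) ^ 2 := by
  rw [abs_mul, abs_neg]
  gcongr
  have h1 : X ^ 3 / 6 + X / 2 = X * (X ^ 2 / 6 + 1 / 2) := by ring
  rw [h1, abs_mul, sq (1 + X ^ 2)]
  have h2 : |X ^ 2 / 6 + 1 / 2| ≤ 1 + X ^ 2 := by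
    rw [abs_of_nonneg (by positivity)]; nlinarith [sq_nonneg X]
  exact mul_le_mul (abs_le_one_add_sq X) h2 (abs_nonneg _) (by positivity)

lemma abs_amp_sub_one_le (hh : 0 < h) : |amp γ h X - 1| ≤ h * (|γ| * (1 + X ^ 2) ^ 2) := by
  rw [amp, add_sub_cancel_left, abs_mul, abs_of_pos hh]
  exact mul_le_mul_of_nonneg_left (abs_corrector_le γ X) hh.le

lemma abs_amp_le (hh : 0 < h) (h1 : h ≤ 1) : |amp γ h X| ≤ (1 + |γ|) * (1 + X ^ 2) ^ 2 := by
  have h2 : |amp γ h X| ≤ 1 + |amp γ h X - 1| := by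
    have := abs_add_le (amp γ h X - 1) 1
    simp only [sub_add_cancel, abs_one] at this
    linarith
  have h3 : (1 : ℝ) ≤ (1 + X ^ 2) ^ 2 := one_le_pow₀ (by nlinarith [sq_nonneg X])
  have h4 : h * (|γ| * (1 + X ^ 2) ^ 2) ≤ 1 * (|γ| * (1 + X ^ 2) ^ 2) := by gcongr
  linarith [abs_amp_sub_one_le (γ := γ) (X := X) hh]

end bounds

/-- The error in the one-dimensional eigenvalue equation for the truncated corrected ground state,
where `χ, χ₁, χ₂` are the values of the cutoff and of its first two derivatives at `x`. -/
lemma abs_oscillator_error_le {γ w c C K h x v χ χ₁ χ₂ : ℝ} (hw : 0 < w) (hγ : γ = c / w ^ 2)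
    (hC : 0 ≤ C) (hK : 0 ≤ K) (hh : 0 < h) (h1 : h ≤ 1)
    (hv : |v - (w ^ 2 * x ^ 2 + c * x ^ 3)| ≤ C * |x| ^ 4)
    (hχ : |χ| ≤ 1) (hχ₁ : |χ₁| ≤ K * |x|) (hχ₂ : |χ₂| ≤ K) :
    |-h ^ 2 * (χ₂ * wave γ h x + 2 * χ₁ * wave' γ h x + χ * wave'' γ h x)
        + v / (w ^ 2 * h ^ 2) * (χ * wave γ h x) - χ * wave γ h x|
      ≤ (γ ^ 2 + (C / w ^ 2) * (1 + |γ|) + 2 * K * (1 + 2 * |γ|) + K * (1 + |γ|)) * 16 ^ 4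
        * h ^ 2 * Real.exp (-(x / h) ^ 2 / 4) := by
  obtain ⟨X, rfl⟩ : ∃ X, x = h * X := ⟨x / h, by field_simp⟩
  have hX : h * X / h = X := by field_simp
  set s := 1 + X ^ 2 with hs
  have hs1 : 1 ≤ s := by nlinarith [sq_nonneg X]
  have hXs : |X| ≤ s := abs_le_one_add_sq X
  have hq : |amp γ h X| ≤ (1 + |γ|) * s ^ 2 := abs_amp_le hh h1
  set p := -γ * (X ^ 3 / 6 + X / 2) with hp
  have hps : |p| ≤ |γ| * s ^ 2 := abs_corrector_le γ X
  -- The quartic remainder of the rescaled potential, of size `h²`.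
  set r := v / (w ^ 2 * h ^ 2) - X ^ 2 - γ * h * X ^ 3 with hr
  have hX4 : |X| ^ 4 ≤ s ^ 2 := by
    rw [show |X| ^ 4 = (X ^ 2) ^ 2 by rw [← sq_abs X]; ring]; gcongr; linarith
  have hrs : |r| ≤ C / w ^ 2 * (h ^ 2 * s ^ 2) := by
    have h2 : r = (v - (w ^ 2 * (h * X) ^ 2 + c * (h * X) ^ 3)) / (w ^ 2 * h ^ 2) := by
      rw [hr, hγ]; field_simp; ring
    rw [h2, abs_div, abs_of_pos (by positivity : 0 < w ^ 2 * h ^ 2), div_le_iff₀ (by positivity)]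
    refine hv.trans ?_
    rw [abs_mul, abs_of_pos hh, mul_pow]
    calc C * (h ^ 4 * |X| ^ 4) ≤ C * (h ^ 4 * s ^ 2) := by gcongr
      _ = C / w ^ 2 * (h ^ 2 * s ^ 2) * (w ^ 2 * h ^ 2) := by field_simp
  -- `D` is `h` times the derivative of the wave in `x`, with the Gaussian removed.
  set D := h * (-γ * (X ^ 2 / 2 + 1 / 2)) - X * amp γ h X with hD
  have hDs : |D| ≤ (1 + 2 * |γ|) * s ^ 3 := by
    have e1 : |h * (-γ * (X ^ 2 / 2 + 1 / 2))| ≤ 1 * (|γ| * s ^ 3) := by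
      rw [abs_mul, abs_mul, abs_neg, abs_of_pos hh,
        abs_of_nonneg (by positivity : 0 ≤ X ^ 2 / 2 + 1 / 2)]
      have : s ≤ s ^ 3 := le_self_pow₀ hs1 (by norm_num)
      gcongr
      nlinarith [sq_nonneg X]
    have e2 : |X * amp γ h X| ≤ s * ((1 + |γ|) * s ^ 2) := by
      rw [abs_mul]; gcongr
    calc |D| ≤ _ := abs_sub _ _
      _ ≤ 1 * (|γ| * s ^ 3) + s * ((1 + |γ|) * s ^ 2) := add_le_add e1 e2
      _ = _ := by ring
  -- Order `1` cancels since the Gaussian has energy `1`, and order `h` cancels by the equation for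
  -- `p`. What survives is the cubic term acting on the correction `h p`, the remainder `r`, and the
  -- commutators with the cutoff.
  have key : -h ^ 2 * (χ₂ * wave γ h (h * X) + 2 * χ₁ * wave' γ h (h * X)
        + χ * wave'' γ h (h * X)) + v / (w ^ 2 * h ^ 2) * (χ * wave γ h (h * X))
        - χ * wave γ h (h * X)
      = (χ * (γ * h ^ 2 * X ^ 3 * p + r * amp γ h X) - 2 * (h * χ₁ * D)
          - h ^ 2 * χ₂ * amp γ h X) * Real.exp (-X ^ 2 / 2) := by
    have hv' : v / (w ^ 2 * h ^ 2) = r + X ^ 2 + γ * h * X ^ 3 := by rw [hr]; ring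
    rw [hv']
    simp only [wave, wave', wave'', hX]
    have ha : amp γ h X = 1 + h * p := rfl
    rw [hD, ha]
    field_simp
    ring
  rw [key, abs_mul, abs_of_pos (Real.exp_pos _), hX]
  have b1 : |χ * (γ * h ^ 2 * X ^ 3 * p + r * amp γ h X)|
      ≤ 1 * (h ^ 2 * (γ ^ 2 * s ^ 4) + h ^ 2 * (C / w ^ 2 * (1 + |γ|) * s ^ 4)) := by
    rw [abs_mul]
    refine mul_le_mul hχ ((abs_add_le _ _).trans (add_le_add ?_ ?_)) (abs_nonneg _) zero_le_one
    · rw [abs_mul, abs_mul, abs_mul, abs_of_pos (by positivity : 0 < h ^ 2), abs_pow]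
      have h3 : |X| ^ 3 ≤ s ^ 2 := by
        calc |X| ^ 3 = |X| * X ^ 2 := by rw [← sq_abs X]; ring
          _ ≤ s * s := by gcongr; linarith
          _ = s ^ 2 := by ring
      calc |γ| * h ^ 2 * |X| ^ 3 * |p| ≤ |γ| * h ^ 2 * s ^ 2 * (|γ| * s ^ 2) := by gcongr
        _ = h ^ 2 * (|γ| ^ 2 * s ^ 4) := by ring
        _ = _ := by rw [sq_abs]
    · rw [abs_mul]
      calc |r| * |amp γ h X| ≤ (C / w ^ 2 * (h ^ 2 * s ^ 2)) * ((1 + |γ|) * s ^ 2) := by gcongr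
        _ = _ := by ring
  -- One factor `h` is explicit; the second comes from `|χ₁| ≤ K |x| = K h |X|`.
  have b2 : |2 * (h * χ₁ * D)| ≤ h ^ 2 * (2 * K * (1 + 2 * |γ|) * s ^ 4) := by
    rw [abs_mul, abs_mul, abs_mul, abs_of_pos hh, abs_two]
    rw [abs_mul, abs_of_pos hh] at hχ₁
    calc 2 * (h * |χ₁| * |D|) ≤ 2 * (h * (K * (h * s)) * ((1 + 2 * |γ|) * s ^ 3)) := by
          gcongr
          exact hχ₁.trans (by gcongr)
      _ = _ := by ring
  have b3 : |h ^ 2 * χ₂ * amp γ h X| ≤ h ^ 2 * (K * (1 + |γ|) * s ^ 4) := by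
    rw [abs_mul, abs_mul, abs_of_pos (by positivity : 0 < h ^ 2)]
    have : s ^ 2 ≤ s ^ 4 := pow_le_pow_right₀ hs1 (by norm_num)
    calc h ^ 2 * |χ₂| * |amp γ h X| ≤ h ^ 2 * K * ((1 + |γ|) * s ^ 4) := by
          gcongr
          exact hq.trans (by gcongr)
      _ = _ := by ring
  set M := γ ^ 2 + C / w ^ 2 * (1 + |γ|) + 2 * K * (1 + 2 * |γ|) + K * (1 + |γ|) with hM
  have b : |χ * (γ * h ^ 2 * X ^ 3 * p + r * amp γ h X) - 2 * (h * χ₁ * D)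
      - h ^ 2 * χ₂ * amp γ h X| ≤ M * h ^ 2 * s ^ 4 := by
    refine (abs_sub _ _).trans ((add_le_add (abs_sub _ _) le_rfl).trans ?_)
    refine (add_le_add (add_le_add b1 b2) b3).trans_eq ?_
    rw [hM]; ring
  have hM0 : 0 ≤ M := by positivity
  calc _ ≤ M * h ^ 2 * s ^ 4 * Real.exp (-X ^ 2 / 2) := by gcongr
    _ = M * h ^ 2 * (s ^ 4 * Real.exp (-X ^ 2 / 2)) := by ring
    _ ≤ M * h ^ 2 * (16 ^ 4 * Real.exp (-X ^ 2 / 4)) :=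
      mul_le_mul_of_nonneg_left (poly_mul_gauss_le X) (by positivity)
    _ = _ := by ring

/-- The truncated corrected ground state is `O(h)`-close to the Gaussian. -/
lemma abs_truncated_wave_sub_gauss_le {γ K h x χ : ℝ} (hh : 0 < h) (h1 : h ≤ 1) (hK : 0 ≤ K)
    (hχ : |χ - 1| ≤ K * |x|) :
    |χ * wave γ h x - Real.exp (-(x / h) ^ 2 / 2)|
      ≤ (K * (1 + |γ|) + |γ|) * 16 ^ 4 * h * Real.exp (-(x / h) ^ 2 / 4) := by
  obtain ⟨X, rfl⟩ : ∃ X, x = h * X := ⟨x / h, by field_simp⟩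
  have hX : h * X / h = X := by field_simp
  have hs1 : 1 ≤ 1 + X ^ 2 := by nlinarith [sq_nonneg X]
  rw [abs_mul, abs_of_pos hh] at hχ
  have key : χ * wave γ h (h * X) - Real.exp (-(h * X / h) ^ 2 / 2)
      = ((χ - 1) * amp γ h X + (amp γ h X - 1)) * Real.exp (-X ^ 2 / 2) := by
    simp only [wave, hX]; ring
  rw [key, abs_mul, abs_of_pos (Real.exp_pos _), hX]
  have b : |(χ - 1) * amp γ h X + (amp γ h X - 1)|
      ≤ (K * (1 + |γ|) + |γ|) * h * (1 + X ^ 2) ^ 4 := by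
    refine (abs_add_le _ _).trans ?_
    rw [abs_mul]
    have e1 : |χ - 1| * |amp γ h X|
        ≤ (K * (h * (1 + X ^ 2))) * ((1 + |γ|) * (1 + X ^ 2) ^ 3) := by
      refine mul_le_mul (hχ.trans ?_) ((abs_amp_le hh h1).trans ?_) (abs_nonneg _) (by positivity)
      · gcongr; exact abs_le_one_add_sq X
      · gcongr ?_ * ?_
        exact pow_le_pow_right₀ hs1 (by norm_num)
    have e2 : |amp γ h X - 1| ≤ h * (|γ| * (1 + X ^ 2) ^ 4) := by
      refine (abs_amp_sub_one_le hh).trans ?_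
      gcongr ?_ * (?_ * ?_)
      exact pow_le_pow_right₀ hs1 (by norm_num)
    refine (add_le_add e1 e2).trans_eq ?_
    ring
  calc _ ≤ (K * (1 + |γ|) + |γ|) * h * (1 + X ^ 2) ^ 4 * Real.exp (-X ^ 2 / 2) := by gcongr
    _ = (K * (1 + |γ|) + |γ|) * h * ((1 + X ^ 2) ^ 4 * Real.exp (-X ^ 2 / 2)) := by ring
    _ ≤ (K * (1 + |γ|) + |γ|) * h * (16 ^ 4 * Real.exp (-X ^ 2 / 4)) :=
      mul_le_mul_of_nonneg_left (poly_mul_gauss_le X) (by positivity)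
    _ = _ := by ring

/-- Growth of the truncated corrected ground state, with a quadratic weight. -/
lemma sq_mul_abs_wave_le {γ h x : ℝ} (hh : 0 < h) (h1 : h ≤ 1) :
    x ^ 2 * |wave γ h x| ≤ (1 + |γ|) * 16 ^ 4 * h ^ 2 * Real.exp (-(x / h) ^ 2 / 4) := by
  obtain ⟨X, rfl⟩ : ∃ X, x = h * X := ⟨x / h, by field_simp⟩
  have hX : h * X / h = X := by field_simp
  have hs1 : 1 ≤ 1 + X ^ 2 := by nlinarith [sq_nonneg X]
  simp only [wave, hX]
  rw [abs_mul, abs_of_pos (Real.exp_pos _)]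
  have b : (h * X) ^ 2 * |amp γ h X| ≤ (1 + |γ|) * h ^ 2 * (1 + X ^ 2) ^ 4 := by
    have e1 : X ^ 2 ≤ (1 + X ^ 2) ^ 2 := by nlinarith [sq_nonneg X]
    calc (h * X) ^ 2 * |amp γ h X| = h ^ 2 * X ^ 2 * |amp γ h X| := by ring
      _ ≤ h ^ 2 * (1 + X ^ 2) ^ 2 * ((1 + |γ|) * (1 + X ^ 2) ^ 2) := by
        gcongr; exact abs_amp_le hh h1
      _ = _ := by ring
  calc _ = (h * X) ^ 2 * |amp γ h X| * Real.exp (-X ^ 2 / 2) := by ring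
    _ ≤ (1 + |γ|) * h ^ 2 * (1 + X ^ 2) ^ 4 * Real.exp (-X ^ 2 / 2) := by gcongr
    _ = (1 + |γ|) * h ^ 2 * ((1 + X ^ 2) ^ 4 * Real.exp (-X ^ 2 / 2)) := by ring
    _ ≤ (1 + |γ|) * h ^ 2 * (16 ^ 4 * Real.exp (-X ^ 2 / 4)) :=
      mul_le_mul_of_nonneg_left (poly_mul_gauss_le X) (by positivity)
    _ = _ := by ring

/-! ### Norms of Gaussians -/

/-- The normalizing factor `h^{-1/2}`. -/
noncomputable def scale (h : ℝ) : ℝ := ((h ^ 2)⁻¹) ^ (1 / 4 : ℝ)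

lemma scale_pos {h : ℝ} (hh : 0 < h) : 0 < scale h := Real.rpow_pos_of_pos (by positivity) _

lemma scale_sq {h : ℝ} (hh : 0 < h) : scale h ^ 2 = h⁻¹ := by
  rw [scale, ← Real.rpow_natCast, ← Real.rpow_mul (by positivity),
    show ((h ^ 2)⁻¹ : ℝ) = (h⁻¹) ^ (2 : ℝ) by norm_cast; rw [inv_pow],
    ← Real.rpow_mul (by positivity)]
  norm_num

lemma eLpNorm_two_real {f : ℝ → ℝ} (hf : Integrable fun x => f x ^ 2) :
    eLpNorm (fun x => (f x : ℂ)) 2 volume = ENNReal.ofReal √(∫ x, f x ^ 2) := by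
  rw [eLpNorm_eq_lintegral_rpow_enorm_toReal two_ne_zero ENNReal.ofNat_ne_top, Real.sqrt_eq_rpow,
    ← ENNReal.ofReal_rpow_of_nonneg (integral_nonneg fun x => sq_nonneg _) (by norm_num),
    ofReal_integral_eq_lintegral_ofReal hf (Eventually.of_forall fun x => sq_nonneg _)]
  congr 2
  funext x
  rw [← sq_abs, ENNReal.ofReal_pow (abs_nonneg _), ← Real.norm_eq_abs, ← Complex.norm_real,
    ofReal_norm]
  norm_num

/-- `scale h` makes the dilation by `h` unitary, so the norm does not depend on `h`. The value `κ =
2` gives the ground state and `κ = 4` the Gaussian majorant of the errors. -/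
lemma eLpNorm_scaled_gauss {h κ : ℝ} (hh : 0 < h) (hκ : 0 < κ) :
    eLpNorm (fun x : ℝ => ((scale h * Real.exp (-(x / h) ^ 2 / κ) : ℝ) : ℂ)) 2 volume
      = ENNReal.ofReal √√(Real.pi * κ / 2) := by
  have h1 : ∀ x : ℝ, (scale h * Real.exp (-(x / h) ^ 2 / κ)) ^ 2
      = h⁻¹ * Real.exp (-(2 / (κ * h ^ 2)) * x ^ 2) := by
    intro x
    rw [mul_pow, scale_sq hh, ← Real.exp_nat_mul]
    congr 2
    push_cast
    field_simp
  rw [eLpNorm_two_real]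
  · simp_rw [h1]
    rw [integral_const_mul, integral_gaussian]
    congr 2
    rw [show Real.pi / (2 / (κ * h ^ 2)) = h ^ 2 * (Real.pi * κ / 2) by field_simp,
      Real.sqrt_mul (by positivity), Real.sqrt_sq hh.le]
    field_simp
  · simp_rw [h1]
    exact (integrable_exp_neg_mul_sq (by positivity)).const_mul _

/-! ### The cutoff -/

section cutoff

variable (χ : ContDiffBump (0 : ℝ))

/-- Zero on the inner ball; outside it the trivial bound `1` is at most `|x| / rIn`. -/
lemma abs_cutoff_sub_one_le (x : ℝ) : |χ x - 1| ≤ χ.rIn⁻¹ * |x| := by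
  have hr := χ.rIn_pos
  by_cases hx : |x| ≤ χ.rIn
  · rw [χ.one_of_mem_closedBall (by simpa [Real.dist_eq] using hx), sub_self, abs_zero]
    positivity
  · have h1 : |χ x - 1| ≤ 1 := by
      rw [abs_le]; constructor <;> linarith [χ.nonneg (x := x), χ.le_one (x := x)]
    refine h1.trans ?_
    rw [inv_mul_eq_div, one_le_div hr]
    exact (not_le.1 hx).le

/-- The cutoff is constant near `0`, so `χ'` vanishes there at least linearly. This crude bound
suffices for `O(h²)`, without the exponential smallness of the Gaussian where `χ'` is supported. -/
lemma exists_cutoff_bounds : ∃ K, 0 ≤ K ∧ ∀ x, |x| ≤ Real.pi →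
    |deriv χ x| ≤ K * |x| ∧ |deriv (deriv χ) x| ≤ K := by
  have hχ : ContDiff ℝ ∞ χ := χ.contDiff
  have h1 := (contDiff_infty_iff_deriv.1 hχ).2
  obtain ⟨C₁, h₁, hC₁⟩ := exists_taylor_bound Real.pi 1 _ h1
  obtain ⟨C₂, h₂, hC₂⟩ := exists_taylor_bound Real.pi 0 _ (contDiff_infty_iff_deriv.1 h1).2
  have h0 : deriv χ 0 = 0 := by
    rw [χ.eventuallyEq_one.deriv_eq]; simp
  refine ⟨max C₁ C₂, le_max_of_le_left h₁, fun x hx => ⟨?_, ?_⟩⟩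
  · have := hC₁ x hx
    simp only [Finset.sum_range_one, iteratedDeriv_zero, h0, pow_one] at this
    refine (le_of_eq (by simp)).trans (this.trans ?_)
    gcongr
    exact le_max_left _ _
  · have := hC₂ x hx
    simp only [Finset.range_zero, Finset.sum_empty, sub_zero, pow_zero, mul_one] at this
    exact this.trans (le_max_right _ _)

/-- The truncated corrected ground state. -/
noncomputable def cutWave (γ h : ℝ) (x : ℝ) : ℝ := χ x * wave γ h x

lemma contDiff_cutWave (γ h : ℝ) : ContDiff ℝ ∞ (cutWave χ γ h) :=
  (ContDiffBump.contDiff χ).mul (contDiff_wave γ h)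

lemma hasCompactSupport_cutWave (γ h : ℝ) : HasCompactSupport (cutWave χ γ h) :=
  χ.hasCompactSupport.mul_right

lemma deriv_cutWave (γ h : ℝ) :
    deriv (cutWave χ γ h) = fun x => deriv χ x * wave γ h x + χ x * wave' γ h x := by
  have hχ : ContDiff ℝ ∞ χ := χ.contDiff
  funext x
  exact ((hχ.differentiable (by simp) x).hasDerivAt.mul (hasDerivAt_wave γ h x)).deriv

lemma deriv_deriv_cutWave (γ h x : ℝ) : deriv (deriv (cutWave χ γ h)) x
    = deriv (deriv χ) x * wave γ h x + 2 * deriv χ x * wave' γ h x + χ x * wave'' γ h x := by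
  have hχ : ContDiff ℝ ∞ χ := χ.contDiff
  have hχ' := (contDiff_infty_iff_deriv.1 hχ).2
  rw [deriv_cutWave]
  have := ((hχ'.differentiable (by simp) x).hasDerivAt.mul (hasDerivAt_wave γ h x)).add
    ((hχ.differentiable (by simp) x).hasDerivAt.mul (hasDerivAt_wave' γ h x))
  refine this.deriv.trans ?_
  ring

lemma deriv_deriv_ofReal_const_mul {u : ℝ → ℝ} (hu : ContDiff ℝ ∞ u) (B x : ℝ) :
    deriv (deriv fun x => ((B * u x : ℝ) : ℂ)) x = ((B * deriv (deriv u) x : ℝ) : ℂ) := by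
  have hu' := (contDiff_infty_iff_deriv.1 hu).2
  have h1 : (deriv fun x => ((B * u x : ℝ) : ℂ)) = fun x => ((B * deriv u x : ℝ) : ℂ) := by
    funext x
    exact ((hu.differentiable (by simp) x).hasDerivAt.const_mul B).ofReal_comp.deriv
  rw [h1]
  exact ((hu'.differentiable (by simp) x).hasDerivAt.const_mul B).ofReal_comp.deriv

/-! ### Normalization in `x` -/

lemma integrable_sq_of_hasCompactSupport {f : ℝ → ℝ} (hf : Continuous f)
    (hc : HasCompactSupport f) : Integrable fun y => f y ^ 2 := by
  simp_rw [sq]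
  exact (hf.mul hf).integrable_of_hasCompactSupport hc.mul_right

/-- The `L²` norm of the truncated corrected ground state, rescaled by `h^{-1/2}`. -/
noncomputable def waveNorm (γ h : ℝ) : ℝ := √(∫ x, (scale h * cutWave χ γ h x) ^ 2)

lemma eLpNorm_const_mul_cutWave (γ h β : ℝ) (hβ : 0 ≤ β) :
    eLpNorm (fun x => ((scale h * β * cutWave χ γ h x : ℝ) : ℂ)) 2 volume
      = ENNReal.ofReal (β * waveNorm χ γ h) := by
  have hi : Integrable fun x => (scale h * cutWave χ γ h x) ^ 2 :=
    integrable_sq_of_hasCompactSupport (continuous_const.mul (contDiff_cutWave χ γ h).continuous)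
    ((hasCompactSupport_cutWave χ γ h).mul_left (f := fun _ => scale h))
  have h1 : (fun x => ((scale h * β * cutWave χ γ h x : ℝ) : ℂ))
      = fun x => (β : ℂ) * ((scale h * cutWave χ γ h x : ℝ) : ℂ) := by
    funext x; push_cast; ring
  have h2 := eLpNorm_const_smul (β : ℂ) (fun x => ((scale h * cutWave χ γ h x : ℝ) : ℂ)) 2 volume
  rw [h1, ENNReal.ofReal_mul hβ, waveNorm, ← eLpNorm_two_real hi]
  refine h2.trans ?_
  rw [← ofReal_norm, Complex.norm_real, Real.norm_of_nonneg hβ]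

/-- The bound must hold for all `h ≤ 1`, where `1 + h p` may vanish or change sign. But `p` is odd,
so it is nonnegative on one side of `0`; there the amplitude is at least `1`, and an interval of
length `h * rIn` on that side already carries enough mass. -/
lemma exists_waveNorm_ge (γ : ℝ) : ∃ c, 0 < c ∧ ∀ h, 0 < h → h ≤ 1 → c ≤ waveNorm χ γ h := by
  have hr := χ.rIn_pos
  refine ⟨Real.exp (-χ.rIn ^ 2 / 2) * √χ.rIn, by positivity, fun h hh h1 => ?_⟩
  -- `σ` is the sign of the side on which `p ≥ 0`.
  obtain ⟨σ, hσ, hσγ⟩ : ∃ σ : ℝ, |σ| = 1 ∧ 0 ≤ -γ * σ := by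
    rcases le_total γ 0 with h | h
    · exact ⟨1, by simp, by linarith⟩
    · exact ⟨-1, by simp, by linarith⟩
  set S : Set ℝ := (fun x => σ * x) ⁻¹' Icc 0 (h * χ.rIn) with hS
  have hσ2 : σ * σ = 1 := by rw [← abs_mul_abs_self, hσ, one_mul]
  have hvol : volume S = ENNReal.ofReal (h * χ.rIn) := by
    rw [hS, Real.volume_preimage_mul_left (by rintro rfl; simp at hσ), abs_inv, hσ]
    simp
  have hSm : MeasurableSet S := measurableSet_Icc.preimage (measurable_const_mul σ)
  have hlow : ∀ x ∈ S, scale h * Real.exp (-χ.rIn ^ 2 / 2) ≤ scale h * cutWave χ γ h x := by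
    intro x hx
    obtain ⟨hx0, hx1⟩ : 0 ≤ σ * x ∧ σ * x ≤ h * χ.rIn := hx
    have habs : |x| = σ * x := by rw [← abs_of_nonneg hx0, abs_mul, hσ, one_mul]
    have hxr : |x| ≤ χ.rIn := by rw [habs]; nlinarith
    refine mul_le_mul_of_nonneg_left ?_ (scale_pos hh).le
    rw [cutWave, χ.one_of_mem_closedBall (by simpa [Real.dist_eq] using hxr), one_mul, wave]
    have hamp : 1 ≤ amp γ h (x / h) := by
      have e : -γ * ((x / h) ^ 3 / 6 + x / h / 2)
          = (-γ * σ) * (σ * x) * (x ^ 2 / (6 * h ^ 3) + 1 / (2 * h)) := by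
        field_simp
        linear_combination γ * x * hσ2
      rw [amp, e]
      have : 0 ≤ (-γ * σ) * (σ * x) * (x ^ 2 / (6 * h ^ 3) + 1 / (2 * h)) := by positivity
      nlinarith
    have hexp : Real.exp (-χ.rIn ^ 2 / 2) ≤ Real.exp (-(x / h) ^ 2 / 2) := by
      refine Real.exp_le_exp.2 ?_
      have : (x / h) ^ 2 ≤ χ.rIn ^ 2 := by
        rw [← sq_abs, abs_div, abs_of_pos hh]
        gcongr
        rw [div_le_iff₀ hh, habs]; linarith
      linarith
    nlinarith [Real.exp_pos (-(x / h) ^ 2 / 2)]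
  have h2 := eLpNorm_const_mul_cutWave χ γ h 1 zero_le_one
  simp only [mul_one, one_mul] at h2
  have h3 : eLpNorm (S.indicator fun _ => ((scale h * Real.exp (-χ.rIn ^ 2 / 2) : ℝ) : ℂ)) 2
      volume ≤ ENNReal.ofReal (waveNorm χ γ h) := by
    rw [← h2]
    refine eLpNorm_mono fun x => ?_
    have hpos : 0 ≤ scale h * Real.exp (-χ.rIn ^ 2 / 2) :=
      mul_nonneg (scale_pos hh).le (Real.exp_pos _).le
    by_cases hx : x ∈ S
    · rw [indicator_of_mem hx, Complex.norm_real, Complex.norm_real, Real.norm_of_nonneg hpos]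
      exact (hlow x hx).trans (le_abs_self _)
    · rw [indicator_of_notMem hx, norm_zero]
      exact norm_nonneg _
  rw [eLpNorm_indicator_const hSm two_ne_zero ENNReal.ofNat_ne_top, hvol, ← ofReal_norm,
    Complex.norm_real, Real.norm_of_nonneg (mul_nonneg (scale_pos hh).le (Real.exp_pos _).le),
    ENNReal.ofReal_rpow_of_nonneg (by positivity) (by norm_num),
    ← ENNReal.ofReal_mul (mul_nonneg (scale_pos hh).le (Real.exp_pos _).le)] at h3
  have h4 := (ENNReal.ofReal_le_ofReal_iff (Real.sqrt_nonneg _)).1 h3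
  refine le_trans (le_of_eq ?_) h4
  -- The square root of the interval's length compensates the normalization, which makes the bound
  -- uniform in `h`.
  have h5 : scale h * √h = 1 := by
    rw [← Real.sqrt_sq (scale_pos hh).le, ← Real.sqrt_mul (sq_nonneg _), scale_sq hh,
      inv_mul_cancel₀ hh.ne', Real.sqrt_one]
  rw [show (1 / (2 : ℝ≥0∞).toReal) = 1 / 2 by norm_num, ← Real.sqrt_eq_rpow,
    Real.sqrt_mul hh.le]
  linear_combination (-(Real.exp (-χ.rIn ^ 2 / 2) * √χ.rIn)) * h5

/-- The Gaussian ground state at scale `h`, normalized up to the constant `π^{1/4}`. -/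
noncomputable def ground (h x : ℝ) : ℝ := scale h * Real.exp (-(x / h) ^ 2 / 2)

lemma hermiteGround_eq (h x : ℝ) : hermiteGround ((h ^ 2)⁻¹) x = ground h x := by
  rw [hermiteGround, ground, scale]
  congr 2
  rw [div_pow]; ring

lemma continuous_ground (h : ℝ) : Continuous (ground h) := by
  unfold ground; fun_prop

lemma eLpNorm_ground {h : ℝ} (hh : 0 < h) :
    eLpNorm (fun x => (ground h x : ℂ)) 2 volume = ENNReal.ofReal √√Real.pi := by
  have := eLpNorm_scaled_gauss hh (κ := 2) two_pos
  rwa [mul_div_cancel_right₀ _ two_ne_zero] at this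

lemma exists_eLpNorm_cutWave_sub_ground_le (γ : ℝ) : ∃ C, 0 ≤ C ∧ ∀ h, 0 < h → h ≤ 1 →
    eLpNorm (fun x => ((scale h * cutWave χ γ h x : ℝ) : ℂ) - (ground h x : ℂ)) 2 volume
      ≤ ENNReal.ofReal (C * h) := by
  have hr := χ.rIn_pos
  set M := (χ.rIn⁻¹ * (1 + |γ|) + |γ|) * 16 ^ 4 with hM
  refine ⟨M * √√(Real.pi * 4 / 2), by positivity, fun h hh h1 => ?_⟩
  have h2 : ∀ x, ‖((scale h * cutWave χ γ h x : ℝ) : ℂ) - (ground h x : ℂ)‖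
      ≤ M * h * ‖((scale h * Real.exp (-(x / h) ^ 2 / 4) : ℝ) : ℂ)‖ := by
    intro x
    rw [← Complex.ofReal_sub, Complex.norm_real, Complex.norm_real, ground, ← mul_sub, norm_mul,
      norm_mul, Real.norm_of_nonneg (scale_pos hh).le, Real.norm_of_nonneg (Real.exp_pos _).le,
      Real.norm_eq_abs]
    calc scale h * |cutWave χ γ h x - Real.exp (-(x / h) ^ 2 / 2)|
        ≤ scale h * (M * h * Real.exp (-(x / h) ^ 2 / 4)) := by
          refine mul_le_mul_of_nonneg_left ?_ (scale_pos hh).le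
          exact abs_truncated_wave_sub_gauss_le hh h1 (by positivity) (abs_cutoff_sub_one_le χ x)
      _ = _ := by ring
  refine (eLpNorm_le_mul_eLpNorm_of_ae_le_mul (ae_of_all _ h2) 2).trans_eq ?_
  rw [eLpNorm_scaled_gauss hh four_pos, ← ENNReal.ofReal_mul (by positivity)]
  congr 1
  ring

/-- Triangle inequality in both directions against the exact Gaussian, whose norm is `π^{1/4}`. -/
lemma exists_abs_waveNorm_sub_le (γ : ℝ) : ∃ C, 0 ≤ C ∧ ∀ h, 0 < h → h ≤ 1 →
    |waveNorm χ γ h - √√Real.pi| ≤ C * h := by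
  obtain ⟨C, hC, hb⟩ := exists_eLpNorm_cutWave_sub_ground_le χ γ
  refine ⟨C, hC, fun h hh h1 => ?_⟩
  have hCh : 0 ≤ C * h := by positivity
  have hw : 0 ≤ waveNorm χ γ h := Real.sqrt_nonneg _
  have h2 := eLpNorm_const_mul_cutWave χ γ h 1 zero_le_one
  simp only [mul_one, one_mul] at h2
  have h3 := eLpNorm_ground hh
  have m1 : AEStronglyMeasurable (fun x => ((scale h * cutWave χ γ h x : ℝ) : ℂ)) volume :=
    (Complex.continuous_ofReal.comp
      (continuous_const.mul (contDiff_cutWave χ γ h).continuous)).aestronglyMeasurable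
  have m2 : AEStronglyMeasurable (fun x => (ground h x : ℂ)) volume :=
    (Complex.continuous_ofReal.comp (continuous_ground h)).aestronglyMeasurable
  have t1 := eLpNorm_add_le (m1.sub m2) m2 (p := 2) one_le_two
  have t2 := eLpNorm_add_le (m2.sub m1) m1 (p := 2) one_le_two
  rw [eLpNorm_sub_comm] at t2
  rw [sub_add_cancel] at t1 t2
  rw [h2, h3] at t1 t2
  have t3 := t1.trans (add_le_add_left (hb h hh h1) _)
  have t4 := t2.trans (add_le_add_left (hb h hh h1) _)
  rw [← ENNReal.ofReal_add hCh (by positivity),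
    ENNReal.ofReal_le_ofReal_iff (by positivity)] at t3
  rw [← ENNReal.ofReal_add hCh hw, ENNReal.ofReal_le_ofReal_iff (by positivity)] at t4
  rw [abs_le]
  constructor <;> linarith

end cutoff

/-! ### The data: amplitude in `y`, box off the damping, expansion of `V` -/

lemma integral_sq_pos {f : ℝ → ℝ} (hf : Continuous f) (hc : HasCompactSupport f) {x : ℝ}
    (hx : f x ≠ 0) : 0 < ∫ y, f y ^ 2 := by
  simp_rw [sq]
  exact (hf.mul hf).integral_pos_of_hasCompactSupport_nonneg_nonzero hc.mul_right
    (fun y => mul_self_nonneg _) (x := x) (mul_ne_zero hx hx)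

lemma exists_normalized_bump (y₀ : ℝ) {ρ R : ℝ} (hρ : 0 < ρ) (hR : 0 < R) : ∃ a : ℝ → ℂ,
    ContDiff ℝ ∞ a ∧ tsupport a ⊆ Metric.closedBall y₀ ρ ∧
      eLpNorm a 2 volume = ENNReal.ofReal R := by
  obtain ⟨f, hfρ⟩ : ∃ f : ContDiffBump y₀, f.rOut = ρ :=
    ⟨⟨ρ / 2, ρ, by positivity, by linarith⟩, rfl⟩
  have hf : ContDiff ℝ ∞ f := f.contDiff
  have hi := integrable_sq_of_hasCompactSupport f.continuous f.hasCompactSupport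
  have hpos : 0 < ∫ y, f y ^ 2 :=
    integral_sq_pos f.continuous f.hasCompactSupport (x := y₀) (by
      rw [f.one_of_mem_closedBall (by simp [f.rIn_pos.le])]; exact one_ne_zero)
  have hN : 0 < √(∫ y, f y ^ 2) := Real.sqrt_pos.2 hpos
  set κ := R / √(∫ y, f y ^ 2) with hκ
  have hκ0 : 0 ≤ κ := by positivity
  refine ⟨fun y => (κ : ℂ) * (f y : ℂ), contDiff_const.mul (Complex.ofRealCLM.contDiff.comp hf),
    ?_, ?_⟩
  · refine tsupport_mul_subset_right.trans ?_
    have : tsupport (fun y => (f y : ℂ)) ⊆ tsupport f :=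
      closure_mono fun y hy => by simpa using hy
    exact this.trans (f.tsupport_eq.trans (by rw [hfρ])).subset
  · have h2 := eLpNorm_const_smul (κ : ℂ) (fun y => (f y : ℂ)) 2 volume
    refine h2.trans ?_
    rw [eLpNorm_two_real hi, ← ofReal_norm, Complex.norm_real, Real.norm_of_nonneg hκ0,
      ← ENNReal.ofReal_mul hκ0, hκ, div_mul_cancel₀ _ hN.ne']

/-- A box around a point of the line `x = 0` that does not meet the support of `b`. -/
lemma exists_box {b : Torus → ℝ}
    (hsupp : tsupport b ∩ {p : Torus | p.1 = 0} ≠ {p : Torus | p.1 = 0}) :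
    ∃ (y₀ δ : ℝ), 0 < δ ∧ δ < Real.pi ∧ ∀ x y : ℝ, |x| ≤ δ → |y - y₀| ≤ δ →
      ((x : Circ), (y : Circ)) ∉ tsupport b := by
  obtain ⟨p, hp, hpb⟩ : ∃ p : Torus, p.1 = 0 ∧ p ∉ tsupport b := by
    by_contra! h
    exact hsupp (inter_eq_right.2 fun p hp => h p hp)
  obtain ⟨y₀, -, hy₀⟩ := exists_mem_Ioc_coe 0 p.2
  have hopen : IsOpen {q : ℝ × ℝ | ((q.1 : Circ), (q.2 : Circ)) ∉ tsupport b} := by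
    have : Continuous fun q : ℝ × ℝ => ((q.1 : Circ), (q.2 : Circ)) :=
      (continuous_quotient_mk'.comp continuous_fst).prodMk
        (continuous_quotient_mk'.comp continuous_snd)
    exact (isClosed_tsupport b).isOpen_compl.preimage this
  have hmem : ((0, y₀) : ℝ × ℝ) ∈ {q : ℝ × ℝ | ((q.1 : Circ), (q.2 : Circ)) ∉ tsupport b} := by
    have : (((0 : ℝ) : Circ), (y₀ : Circ)) = p := by
      rw [hy₀]; exact Prod.ext (by simp [hp]) rfl
    simpa only [mem_ofPred_eq, this] using hpb
  obtain ⟨ε, hε, hball⟩ := Metric.isOpen_iff.1 hopen _ hmem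
  have hπ := Real.pi_gt_three
  -- Half of `ε` puts the closed box inside the open ball of the sup metric; the bound `1` keeps it
  -- within one period.
  refine ⟨y₀, min (ε / 2) 1, by positivity, (min_le_right _ _).trans_lt (by linarith),
    fun x y hx hy => ?_⟩
  have hlt : min (ε / 2) 1 < ε := (min_le_left _ _).trans_lt (by linarith)
  have : ((x, y) : ℝ × ℝ) ∈ Metric.ball ((0, y₀) : ℝ × ℝ) ε := by
    rw [Metric.mem_ball, Prod.dist_eq, max_lt_iff, Real.dist_eq, Real.dist_eq, sub_zero]
    exact ⟨hx.trans_lt hlt, hy.trans_lt hlt⟩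
  exact hball this

/-- Taylor's formula at orders `2` and `4`, with `c = V'''(0)/6`. The first bound controls the terms
with derivatives of `a`, the second the oscillator equation. -/
lemma exists_potential_bounds {V : Circ → ℝ} (hV : IsPotential V) : ∃ (c C : ℝ), 0 ≤ C ∧
    ∀ x : ℝ, |x| ≤ Real.pi → |V (x : Circ)| ≤ C * x ^ 2 ∧
      |V (x : Circ) - (√(iteratedDeriv 2 (fun x : ℝ => V (x : Circ)) 0 / 2) ^ 2 * x ^ 2
        + c * x ^ 3)| ≤ C * |x| ^ 4 := by
  obtain ⟨C₁, h₁, hC₁⟩ := exists_taylor_bound Real.pi 2 _ hV.smooth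
  obtain ⟨C₂, h₂, hC₂⟩ := exists_taylor_bound Real.pi 4 _ hV.smooth
  have h0 : V ((0 : ℝ) : Circ) = 0 := by simpa using hV.zero
  refine ⟨iteratedDeriv 3 (fun x : ℝ => V (x : Circ)) 0 / 6, max C₁ C₂, le_max_of_le_left h₁,
    fun x hx => ⟨?_, ?_⟩⟩
  · have := hC₁ x hx
    simp only [Finset.sum_range_succ, Finset.sum_range_zero, iteratedDeriv_zero, iteratedDeriv_one,
      h0, hV.deriv_zero, zero_div, zero_mul, add_zero, sub_zero, sq_abs] at this
    refine this.trans ?_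
    gcongr
    exact le_max_left _ _
  · have := hC₂ x hx
    simp only [Finset.sum_range_succ, Finset.sum_range_zero, iteratedDeriv_zero, iteratedDeriv_one,
      h0, hV.deriv_zero, zero_div, zero_mul, add_zero, zero_add] at this
    rw [Real.sq_sqrt (by linarith [hV.deriv2_pos])]
    refine le_trans (le_of_eq ?_) (this.trans ?_)
    · congr 1
    · gcongr
      exact le_max_right _ _

/-! ### The quasimode and its estimates -/

section quasimode

variable (χ : ContDiffBump (0 : ℝ)) (γ w y₀ : ℝ) (a : ℝ → ℂ)

/-- The normalized `x`-profile of the quasimode. -/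
noncomputable def xProfile (h x : ℝ) : ℂ :=
  ((scale h * (√√Real.pi / waveNorm χ γ h) * cutWave χ γ h x : ℝ) : ℂ)

/-- The quasimode: a truncated corrected Hermite function in `x` times a wave packet in `y`. -/
noncomputable def quasimode (h : ℝ) (p : Torus) : ℂ :=
  periodize 0 (xProfile χ γ h) p.1 * periodize y₀ (osc (w * h ^ 2) a) p.2

variable {χ a y₀}

lemma contDiff_xProfile (h : ℝ) : ContDiff ℝ ∞ (xProfile χ γ h) :=
  Complex.ofRealCLM.contDiff.comp (contDiff_const.mul (contDiff_cutWave χ γ h))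

lemma xProfile_ne_zero {h x : ℝ} (hx : xProfile χ γ h x ≠ 0) : |x| < χ.rOut := by
  by_contra hc
  apply hx
  have : χ x = 0 := χ.zero_of_le_dist (by simpa [Real.dist_eq] using hc)
  simp [xProfile, cutWave, this]

lemma tsupport_xProfile_subset (hχ : χ.rOut < Real.pi) (h : ℝ) :
    tsupport (xProfile χ γ h) ⊆ Ioo (0 - Real.pi) (0 + Real.pi) := by
  have h1 : tsupport (xProfile χ γ h) ⊆ Metric.closedBall 0 χ.rOut :=
    closure_minimal (fun x hx => by
      simpa [Real.dist_eq] using (xProfile_ne_zero γ hx).le) Metric.isClosed_closedBall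
  intro x hx
  have := h1 hx
  rw [Metric.mem_closedBall, Real.dist_eq, sub_zero, abs_le] at this
  constructor <;> linarith

lemma waveNorm_pos {h : ℝ} (hh : 0 < h) (h1 : h ≤ 1) : 0 < waveNorm χ γ h := by
  obtain ⟨c, hc, hb⟩ := exists_waveNorm_ge χ γ
  exact hc.trans_le (hb h hh h1)

/-- The profile gets exactly the norm `π^{1/4}` of the Gaussian it approximates; the amplitude `a`
is given the inverse norm. -/
lemma eLpNorm_xProfile {h : ℝ} (hh : 0 < h) (h1 : h ≤ 1) :
    eLpNorm (xProfile χ γ h) 2 volume = ENNReal.ofReal √√Real.pi := by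
  have hp := waveNorm_pos (χ := χ) γ hh h1
  have := eLpNorm_const_mul_cutWave χ γ h (√√Real.pi / waveNorm χ γ h) (by positivity)
  rwa [div_mul_cancel₀ _ hp.ne'] at this

/-- The product of functions on the two circles, viewed on the torus. -/
lemma eLpNorm_torus_mul {F G : Circ → ℂ} (hF : AEStronglyMeasurable F volume)
    (hG : AEStronglyMeasurable G volume) :
    eLpNorm (fun p : Torus => F p.1 * G p.2) 2 volume = eLpNorm F 2 volume * eLpNorm G 2 volume :=
  eLpNorm_mul_prod hF hG

lemma eLpNorm_osc (μ : ℝ) (f : ℝ → ℂ) (q : ℝ≥0∞) (m : Measure ℝ) :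
    eLpNorm (osc μ f) q m = eLpNorm f q m :=
  eLpNorm_congr_norm_ae (ae_of_all _ (norm_osc μ f))

lemma eLpNorm_quasimode (hχ : χ.rOut < Real.pi) (ha : ContDiff ℝ ∞ a)
    (has : tsupport a ⊆ Ioo (y₀ - Real.pi) (y₀ + Real.pi))
    (han : eLpNorm a 2 volume = ENNReal.ofReal (√√Real.pi)⁻¹) {h : ℝ} (hh : 0 < h) (h1 : h ≤ 1) :
    eLpNorm (quasimode χ γ w y₀ a h) 2 volume = 1 := by
  have hf := contDiff_xProfile (χ := χ) γ h
  have hfs := tsupport_xProfile_subset γ hχ h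
  have hg := contDiff_osc (w * h ^ 2) ha
  have hgs := (tsupport_osc_subset (w * h ^ 2) a).trans has
  refine (eLpNorm_torus_mul (continuous_periodize hf hfs).aestronglyMeasurable
    (continuous_periodize hg hgs).aestronglyMeasurable).trans ?_
  rw [eLpNorm_periodize_of_support hf.continuous hfs,
    eLpNorm_periodize_of_support hg.continuous hgs, eLpNorm_osc, eLpNorm_xProfile γ hh h1, han,
    ← ENNReal.ofReal_mul (by positivity), mul_inv_cancel₀ (by positivity), ENNReal.ofReal_one]

lemma isSmooth_quasimode (hχ : χ.rOut < Real.pi) (ha : ContDiff ℝ ∞ a)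
    (has : tsupport a ⊆ Ioo (y₀ - Real.pi) (y₀ + Real.pi)) (h : ℝ) :
    IsSmooth (quasimode χ γ w y₀ a h) :=
  isSmooth_tensor (contDiff_xProfile γ h) (tsupport_xProfile_subset γ hχ h) (contDiff_osc _ ha)
    ((tsupport_osc_subset _ a).trans has)

lemma eq_zero_of_quasimode_ne_zero {b : Torus → ℝ}
    (hb : ∀ x y : ℝ, |x| < χ.rOut → y ∈ tsupport a → ((x : Circ), (y : Circ)) ∉ tsupport b)
    {h : ℝ} {p : Torus} (hp : quasimode χ γ w y₀ a h p ≠ 0) : b p = 0 := by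
  obtain ⟨x, hx, hxp⟩ := exists_mem_Ioc_coe 0 p.1
  obtain ⟨y, hy, hyp⟩ := exists_mem_Ioc_coe y₀ p.2
  rw [quasimode, ← hxp, ← hyp, periodize_coe hx, periodize_coe hy] at hp
  have h1 := xProfile_ne_zero γ (left_ne_zero_of_mul hp)
  have h2 : y ∈ tsupport a := by
    refine subset_tsupport _ fun h0 => right_ne_zero_of_mul hp ?_
    rw [osc, h0, zero_mul]
  have := image_eq_zero_of_notMem_tsupport (hb x y h1 h2)
  rwa [hxp, hyp] at this

/-- A function on the torus with a pointwise Gaussian bound in `x`. -/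
lemma exists_eLpNorm_le_of_gauss_bound : ∃ K : ℝ, 0 ≤ K ∧ ∀ (h M : ℝ) (Φ : Torus → ℂ), 0 < h →
    0 ≤ M → (∀ x ∈ Ioc (-Real.pi) Real.pi, ∀ z : Circ,
      ‖Φ ((x : Circ), z)‖ ≤ M * (scale h * Real.exp (-(x / h) ^ 2 / 4))) →
    eLpNorm Φ 2 volume ≤ ENNReal.ofReal (K * M) := by
  set k := eLpNorm (fun _ : Circ => (1 : ℂ)) 2 volume with hk
  have hk' : k ≠ ⊤ := (memLp_const (1 : ℂ)).eLpNorm_ne_top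
  refine ⟨√√(Real.pi * 4 / 2) * k.toReal, by positivity, fun h M Φ hh hM hb => ?_⟩
  set g : ℝ → ℂ := fun x => ((scale h * Real.exp (-(x / h) ^ 2 / 4) : ℝ) : ℂ) with hg
  have hgc : Continuous g := by rw [hg]; fun_prop
  have h1 : ∀ p : Torus, ‖Φ p‖ ≤ M * ‖periodize 0 g p.1 * (fun _ : Circ => (1 : ℂ)) p.2‖ := by
    rintro ⟨z₁, z⟩
    obtain ⟨x, hx, rfl⟩ := exists_mem_Ioc_coe 0 z₁
    simp only [periodize_coe hx, mul_one]
    rw [zero_sub, zero_add] at hx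
    refine (hb x hx z).trans_eq ?_
    rw [hg]
    simp only [Complex.norm_real]
    rw [Real.norm_of_nonneg (mul_nonneg (scale_pos hh).le (Real.exp_pos _).le)]
  refine (eLpNorm_le_mul_eLpNorm_of_ae_le_mul (ae_of_all _ h1) 2).trans ?_
  have h2 : eLpNorm (periodize 0 g) 2 volume ≤ ENNReal.ofReal √√(Real.pi * 4 / 2) := by
    rw [eLpNorm_periodize 0 hgc.aestronglyMeasurable, ← eLpNorm_scaled_gauss hh four_pos]
    exact eLpNorm_mono_measure _ Measure.restrict_le_self
  have h3 := eLpNorm_torus_mul (measurable_periodize 0 hgc.measurable).aestronglyMeasurable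
    (aestronglyMeasurable_const (b := (1 : ℂ)) (μ := (volume : Measure Circ)))
  rw [h3, ← hk]
  calc ENNReal.ofReal M * (eLpNorm (periodize 0 g) 2 volume * k)
      ≤ ENNReal.ofReal M * (ENNReal.ofReal √√(Real.pi * 4 / 2) * ENNReal.ofReal k.toReal) := by
        rw [ENNReal.ofReal_toReal hk']; gcongr
    _ = _ := by
        rw [← ENNReal.ofReal_mul (by positivity), ← ENNReal.ofReal_mul hM]
        congr 1; ring

variable {γ w}

/-- Two sources of error: the oscillator equation in `x`, multiplied by `a`, and the terms where
`∂_y²` hits `a` at least once. The latter carry `V = O(x²)`, which is worth `h²` against the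
Gaussian. -/
lemma norm_quasimode_error_le {V : Circ → ℝ} {b : Torus → ℝ} {c C K A c₀ : ℝ} (hw : 0 < w)
    (hγ : γ = c / w ^ 2) (hC : 0 ≤ C) (hK : 0 ≤ K) (hc₀ : 0 < c₀)
    (hV : ∀ x : ℝ, |x| ≤ Real.pi → |V (x : Circ)| ≤ C * x ^ 2 ∧
      |V (x : Circ) - (w ^ 2 * x ^ 2 + c * x ^ 3)| ≤ C * |x| ^ 4)
    (hKχ : ∀ x, |x| ≤ Real.pi → |deriv χ x| ≤ K * |x| ∧ |deriv (deriv χ) x| ≤ K)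
    (hAa : ∀ y, ‖a y‖ ≤ A ∧ ‖deriv a y‖ ≤ A ∧ ‖deriv (deriv a) y‖ ≤ A)
    (hχ : χ.rOut < Real.pi) (ha : ContDiff ℝ ∞ a)
    (has : tsupport a ⊆ Ioo (y₀ - Real.pi) (y₀ + Real.pi))
    (hb : ∀ x y : ℝ, |x| < χ.rOut → y ∈ tsupport a → ((x : Circ), (y : Circ)) ∉ tsupport b)
    {h : ℝ} (hh : 0 < h) (h1 : h ≤ 1) (hn : c₀ ≤ waveNorm χ γ h)
    {x : ℝ} (hx : x ∈ Ioc (-Real.pi) Real.pi) (z : Circ) :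
    ‖dampedOp V b h (quasimode χ γ w y₀ a h) ((x : Circ), z)‖
      ≤ √√Real.pi / c₀ * ((γ ^ 2 + (C / w ^ 2) * (1 + |γ|) + 2 * K * (1 + 2 * |γ|)
          + K * (1 + |γ|)) * A + C * (1 + |γ|) * (A + 2 / w * A)) * 16 ^ 4 * h ^ 2
        * (scale h * Real.exp (-(x / h) ^ 2 / 4)) := by
  have hf := contDiff_xProfile (χ := χ) γ h
  have hfs := tsupport_xProfile_subset γ hχ h
  have hg := contDiff_osc (w * h ^ 2) ha
  have hgs := (tsupport_osc_subset (w * h ^ 2) a).trans has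
  obtain ⟨y, hy, rfl⟩ := exists_mem_Ioc_coe y₀ z
  have hx' : x ∈ Ioc (0 - Real.pi) (0 + Real.pi) := by simpa using hx
  have hxpi : |x| ≤ Real.pi := abs_le.2 ⟨hx.1.le, hx.2⟩
  have heq := congrFun (dampedOp_tensor (V := V) (h := h) hf hfs hg hgs
    (fun p hp => eq_zero_of_quasimode_ne_zero (p := p) γ w hb hp)) ((x : Circ), (y : Circ))
  change dampedOp V b h (quasimode χ γ w y₀ a h) _ = _ at heq
  simp only [periodize_coe hx', periodize_coe hy] at heq
  have hN0 : 0 < waveNorm χ γ h := hc₀.trans_le hn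
  set B := scale h * (√√Real.pi / waveNorm χ γ h) with hB
  have hB0 : 0 ≤ B := mul_nonneg (scale_pos hh).le (by positivity)
  have hBle : B ≤ scale h * (√√Real.pi / c₀) :=
    mul_le_mul_of_nonneg_left (by gcongr) (scale_pos hh).le
  have hf2 : deriv (deriv (xProfile χ γ h)) x = ((B * deriv (deriv (cutWave χ γ h)) x : ℝ) : ℂ) :=
    deriv_deriv_ofReal_const_mul (contDiff_cutWave χ γ h) B x
  rw [hf2, deriv_deriv_osc _ ha, deriv_deriv_cutWave] at heq
  obtain ⟨hV1, hV2⟩ := hV x hxpi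
  obtain ⟨hχ1, hχ2⟩ := hKχ x hxpi
  have hE := abs_oscillator_error_le hw hγ hC hK hh h1 hV2
    (by rw [abs_of_nonneg χ.nonneg]; exact χ.le_one : |χ x| ≤ 1) hχ1 hχ2
  set E := -h ^ 2 * (deriv (deriv χ) x * wave γ h x + 2 * deriv χ x * wave' γ h x
    + χ x * wave'' γ h x) + V x / (w ^ 2 * h ^ 2) * (χ x * wave γ h x) - χ x * wave γ h x with hEd
  set ex := Complex.exp (Complex.I * ((y / (w * h ^ 2) : ℝ) : ℂ)) with hex
  have hexn : ‖ex‖ = 1 := by rw [hex, mul_comm, Complex.norm_exp_ofReal_mul_I]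
  -- Of the three terms of `∂_y²`, the one with both derivatives on the phase gives `V/(w² h²)` and
  -- joins `E`. The mixed term has `h² · 2/(w h²) = 2/w`, with no power of `h` left.
  have hval : dampedOp V b h (quasimode χ γ w y₀ a h) ((x : Circ), (y : Circ))
      = (B : ℂ) * ((E : ℂ) * a y - (V x : ℂ) * ((χ x * wave γ h x : ℝ) : ℂ)
        * ((h : ℂ) ^ 2 * deriv (deriv a) y + Complex.I * ((2 / w : ℝ) : ℂ) * deriv a y)) * ex := by
    rw [heq, hEd]
    simp only [osc, xProfile, cutWave, ← hex, ← hB]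
    have hwc : (w : ℂ) ≠ 0 := by exact_mod_cast hw.ne'
    have hhc : (h : ℂ) ≠ 0 := by exact_mod_cast hh.ne'
    push_cast
    field_simp
    ring
  obtain ⟨ha0, ha1, ha2⟩ := hAa y
  rw [hval, norm_mul, norm_mul, hexn, mul_one, Complex.norm_real, Real.norm_of_nonneg hB0]
  set e4 := Real.exp (-(x / h) ^ 2 / 4) with he4
  have he4p : 0 < e4 := Real.exp_pos _
  have b1 : ‖(E : ℂ) * a y‖ ≤ (γ ^ 2 + (C / w ^ 2) * (1 + |γ|) + 2 * K * (1 + 2 * |γ|)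
      + K * (1 + |γ|)) * 16 ^ 4 * h ^ 2 * e4 * A := by
    rw [norm_mul, Complex.norm_real, Real.norm_eq_abs]
    exact mul_le_mul hE ha0 (norm_nonneg _) (by positivity)
  have b2 : ‖(V x : ℂ) * ((χ x * wave γ h x : ℝ) : ℂ)‖
      ≤ C * ((1 + |γ|) * 16 ^ 4 * h ^ 2 * e4) := by
    rw [norm_mul, Complex.norm_real, Complex.norm_real, Real.norm_eq_abs, Real.norm_eq_abs,
      abs_mul, abs_of_nonneg χ.nonneg]
    calc |V x| * (χ x * |wave γ h x|) ≤ (C * x ^ 2) * (1 * |wave γ h x|) := by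
          refine mul_le_mul hV1 (mul_le_mul_of_nonneg_right χ.le_one (abs_nonneg _))
            (mul_nonneg χ.nonneg (abs_nonneg _)) (by positivity)
      _ = C * (x ^ 2 * |wave γ h x|) := by ring
      _ ≤ _ := mul_le_mul_of_nonneg_left (sq_mul_abs_wave_le hh h1) hC
  have b3 : ‖(h : ℂ) ^ 2 * deriv (deriv a) y + Complex.I * ((2 / w : ℝ) : ℂ) * deriv a y‖
      ≤ A + 2 / w * A := by
    refine (norm_add_le _ _).trans (add_le_add ?_ ?_)
    · rw [norm_mul, norm_pow, Complex.norm_real, Real.norm_of_nonneg hh.le]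
      calc h ^ 2 * ‖deriv (deriv a) y‖ ≤ 1 * A := by
            gcongr; exact pow_le_one₀ hh.le h1
        _ = A := one_mul A
    · rw [norm_mul, norm_mul, Complex.norm_I, one_mul, Complex.norm_real,
        Real.norm_of_nonneg (by positivity)]
      gcongr
  have b4 : ‖(E : ℂ) * a y - (V x : ℂ) * ((χ x * wave γ h x : ℝ) : ℂ)
        * ((h : ℂ) ^ 2 * deriv (deriv a) y + Complex.I * ((2 / w : ℝ) : ℂ) * deriv a y)‖
      ≤ (γ ^ 2 + (C / w ^ 2) * (1 + |γ|) + 2 * K * (1 + 2 * |γ|)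
      + K * (1 + |γ|)) * 16 ^ 4 * h ^ 2 * e4 * A
      + C * ((1 + |γ|) * 16 ^ 4 * h ^ 2 * e4) * (A + 2 / w * A) := by
    refine (norm_sub_le _ _).trans (add_le_add b1 ?_)
    rw [norm_mul]
    exact mul_le_mul b2 b3 (norm_nonneg _) (by positivity)
  refine (mul_le_mul hBle b4 (norm_nonneg _)
    (mul_nonneg (scale_pos hh).le (by positivity))).trans_eq ?_
  ring

lemma exists_eLpNorm_dampedOp_le {V : Circ → ℝ} {b : Torus → ℝ} {c C : ℝ} (hw : 0 < w)
    (hγ : γ = c / w ^ 2) (hC : 0 ≤ C)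
    (hV : ∀ x : ℝ, |x| ≤ Real.pi → |V (x : Circ)| ≤ C * x ^ 2 ∧
      |V (x : Circ) - (w ^ 2 * x ^ 2 + c * x ^ 3)| ≤ C * |x| ^ 4)
    (hχ : χ.rOut < Real.pi) (ha : ContDiff ℝ ∞ a)
    (has : tsupport a ⊆ Ioo (y₀ - Real.pi) (y₀ + Real.pi))
    (hb : ∀ x y : ℝ, |x| < χ.rOut → y ∈ tsupport a → ((x : Circ), (y : Circ)) ∉ tsupport b) :
    ∃ M, ∀ h ∈ Ioc (0 : ℝ) 1, eLpNorm (dampedOp V b h (quasimode χ γ w y₀ a h)) 2 volume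
      ≤ ENNReal.ofReal (M * h ^ 2) := by
  obtain ⟨K, hK, hKχ⟩ := exists_cutoff_bounds χ
  obtain ⟨c₀, hc₀, hn⟩ := exists_waveNorm_ge χ γ
  obtain ⟨k, hk, hkb⟩ := exists_eLpNorm_le_of_gauss_bound
  have ha1 := contDiff_deriv ha
  have has1 := (tsupport_deriv_subset (f := a)).trans has
  obtain ⟨A₀, hA₀, hb₀⟩ := exists_norm_le_of_tsupport ha.continuous has
  obtain ⟨A₁, hA₁, hb₁⟩ := exists_norm_le_of_tsupport ha1.continuous has1
  obtain ⟨A₂, hA₂, hb₂⟩ := exists_norm_le_of_tsupport (contDiff_deriv ha1).continuous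
    (tsupport_deriv_subset.trans has1)
  obtain ⟨Q, hQ, hbQ⟩ : ∃ Q : ℝ, 0 ≤ Q ∧ ∀ h ∈ Ioc (0 : ℝ) 1, ∀ x ∈ Ioc (-Real.pi) Real.pi,
      ∀ z : Circ, ‖dampedOp V b h (quasimode χ γ w y₀ a h) ((x : Circ), z)‖
        ≤ Q * h ^ 2 * (scale h * Real.exp (-(x / h) ^ 2 / 4)) := by
    -- The constant is read off from the pointwise estimate by unification; it does not involve `h`.
    refine ⟨_, ?_, fun h hh x hx z => norm_quasimode_error_le (A := A₀ + A₁ + A₂) hw hγ hC hK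
      hc₀ hV hKχ (fun y => ⟨(hb₀ y).trans (by linarith), (hb₁ y).trans (by linarith),
        (hb₂ y).trans (by linarith)⟩) hχ ha has hb hh.1 hh.2 (hn h hh.1 hh.2) hx z⟩
    positivity
  refine ⟨k * Q, fun h hh => (hkb h _ _ hh.1 (by positivity) (hbQ h hh)).trans_eq ?_⟩
  rw [mul_assoc]

variable (γ)

/-- The difference factors as `D(x)` times the wave packet in `y`. With `β` the normalizing ratio,
`D` is `β` times (truncated wave minus Gaussian) plus `(β - 1)` times the Gaussian, and both are
`O(h)`. -/
lemma exists_eLpNorm_quasimode_sub_profile_le (ha : ContDiff ℝ ∞ a)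
    (han : eLpNorm a 2 volume = ENNReal.ofReal (√√Real.pi)⁻¹) (w y₀ : ℝ) :
    ∃ M, ∀ h ∈ Ioc (0 : ℝ) 1, eLpNorm (fun q : ℝ × ℝ =>
        quasimode χ γ w y₀ a h ((q.1 : Circ), (q.2 : Circ)) - profile w a h q) 2
      (volume.restrict (Ioo (-Real.pi) Real.pi ×ˢ Ioo (y₀ - Real.pi) (y₀ + Real.pi)))
      ≤ ENNReal.ofReal (M * h) := by
  obtain ⟨c₀, hc₀, hn⟩ := exists_waveNorm_ge χ γ
  obtain ⟨C₁, hC₁, hb₁⟩ := exists_eLpNorm_cutWave_sub_ground_le χ γ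
  obtain ⟨C₂, hC₂, hb₂⟩ := exists_abs_waveNorm_sub_le χ γ
  refine ⟨(√√Real.pi / c₀ * C₁ + C₂ / c₀ * √√Real.pi) * (√√Real.pi)⁻¹, fun h ⟨hh, h1⟩ => ?_⟩
  set N := waveNorm χ γ h with hN
  have hN0 : 0 < N := hc₀.trans_le (hn h hh h1)
  set β := √√Real.pi / N with hβ
  set D : ℝ → ℂ := fun x => xProfile χ γ h x - (ground h x : ℂ) with hD
  have hDc : Continuous D := (contDiff_xProfile γ h).continuous.sub
    (Complex.continuous_ofReal.comp (continuous_ground h))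
  have hDle : eLpNorm D 2 volume
      ≤ ENNReal.ofReal ((√√Real.pi / c₀ * C₁ + C₂ / c₀ * √√Real.pi) * h) := by
    have hsplit : D = (β : ℂ) • (fun x => ((scale h * cutWave χ γ h x : ℝ) : ℂ)
        - (ground h x : ℂ)) + ((β - 1 : ℝ) : ℂ) • fun x => (ground h x : ℂ) := by
      funext x
      simp only [hD, xProfile, Pi.add_apply, Pi.smul_apply, smul_eq_mul, ← hN, ← hβ]
      push_cast
      ring
    have m1 : Continuous fun x => ((scale h * cutWave χ γ h x : ℝ) : ℂ) - (ground h x : ℂ) :=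
      (Complex.continuous_ofReal.comp
        (continuous_const.mul (contDiff_cutWave χ γ h).continuous)).sub
        (Complex.continuous_ofReal.comp (continuous_ground h))
    have m2 : Continuous fun x => (ground h x : ℂ) :=
      Complex.continuous_ofReal.comp (continuous_ground h)
    rw [hsplit]
    refine (eLpNorm_add_le (m1.const_smul _).aestronglyMeasurable
      (m2.const_smul _).aestronglyMeasurable one_le_two).trans ?_
    rw [eLpNorm_const_smul, eLpNorm_const_smul, eLpNorm_ground hh, ← ofReal_norm, ← ofReal_norm,
      Complex.norm_real, Complex.norm_real]
    have e1 : ‖β‖ ≤ √√Real.pi / c₀ := by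
      rw [Real.norm_of_nonneg (by positivity)]
      exact div_le_div_of_nonneg_left (by positivity) hc₀ (hn h hh h1)
    have e2 : ‖β - 1‖ ≤ C₂ / c₀ * h := by
      rw [hβ, div_sub_one hN0.ne', norm_div, Real.norm_eq_abs, abs_sub_comm,
        Real.norm_of_nonneg hN0.le]
      calc |N - √√Real.pi| / N ≤ C₂ * h / c₀ := by
            gcongr
            · exact hb₂ h hh h1
            · exact hn h hh h1
        _ = C₂ / c₀ * h := by ring
    calc _ ≤ ENNReal.ofReal (√√Real.pi / c₀) * ENNReal.ofReal (C₁ * h)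
          + ENNReal.ofReal (C₂ / c₀ * h) * ENNReal.ofReal √√Real.pi := by
          gcongr
          exact hb₁ h hh h1
      _ = _ := by
          rw [← ENNReal.ofReal_mul (by positivity), ← ENNReal.ofReal_mul (by positivity),
            ← ENNReal.ofReal_add (by positivity) (by positivity)]
          congr 1; ring
  have hae : (fun q : ℝ × ℝ =>
        quasimode χ γ w y₀ a h ((q.1 : Circ), (q.2 : Circ)) - profile w a h q)
      =ᵐ[volume.restrict (Ioo (-Real.pi) Real.pi ×ˢ Ioo (y₀ - Real.pi) (y₀ + Real.pi))]
      fun q => D q.1 * osc (w * h ^ 2) a q.2 := by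
    filter_upwards [ae_restrict_mem (measurableSet_Ioo.prod measurableSet_Ioo)] with q hq
    obtain ⟨hq1, hq2⟩ := hq
    have hq1' : q.1 ∈ Ioc (0 - Real.pi) (0 + Real.pi) := by
      simpa using Ioo_subset_Ioc_self hq1
    simp only [quasimode, profile, periodize_coe hq1', periodize_coe (Ioo_subset_Ioc_self hq2), hD,
      hermiteGround_eq, osc]
    ring
  rw [eLpNorm_congr_ae hae]
  refine (eLpNorm_mono_measure _ Measure.restrict_le_self).trans ?_
  have := eLpNorm_mul_prod (μ := (volume : Measure ℝ)) (ν := (volume : Measure ℝ))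
    hDc.aestronglyMeasurable (contDiff_osc (w * h ^ 2) ha).continuous.aestronglyMeasurable
  refine this.trans_le ?_
  rw [eLpNorm_osc, han]
  refine (mul_le_mul_left hDle _).trans_eq ?_
  rw [← ENNReal.ofReal_mul (by positivity)]
  congr 1; ring

lemma exists_yFreqMass_quasimode_le (hw : 0 < w) (hχ : χ.rOut < Real.pi) (ha : ContDiff ℝ ∞ a)
    (has : tsupport a ⊆ Ioo (y₀ - Real.pi) (y₀ + Real.pi)) (N : ℕ) :
    ∃ M, ∀ h ∈ Ioc (0 : ℝ) 1, yFreqMass (quasimode χ γ w y₀ a h)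
        {n : ℤ | ¬ (1 / (2 * w) ≤ h ^ 2 * |(n : ℝ)| ∧ h ^ 2 * |(n : ℝ)| ≤ 2 / w)}
      ≤ ENNReal.ofReal (M * h ^ N) := by
  obtain ⟨M, hM⟩ := tsum_fourierCoeff_osc_le ha has N
  refine ⟨2 * Real.pi * (√√Real.pi ^ 2 * (M ^ 2 * (2 * w) ^ (2 * N))), fun h ⟨hh, h1⟩ => ?_⟩
  set F := periodize 0 (xProfile χ γ h)
  set G := periodize y₀ (osc (w * h ^ 2) a)
  set S := {n : ℤ | ¬ (1 / (2 * w) ≤ h ^ 2 * |(n : ℝ)| ∧ h ^ 2 * |(n : ℝ)| ≤ 2 / w)}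
  have hf := contDiff_xProfile (χ := χ) γ h
  have hfs := tsupport_xProfile_subset γ hχ h
  have hF : ∫⁻ x, ‖F x‖ₑ ^ 2 = ENNReal.ofReal (√√Real.pi ^ 2) := by
    have h2 : eLpNorm F 2 volume = ENNReal.ofReal √√Real.pi := by
      rw [eLpNorm_periodize_of_support hf.continuous hfs, eLpNorm_xProfile γ hh h1]
    rw [ENNReal.ofReal_pow (by positivity), ← h2]
    have := eLpNorm_nnreal_pow_eq_lintegral (f := F) (μ := volume) (p := 2) two_ne_zero
    simpa using this.symm
  -- The window is `[1/2, 2]` times the frequency `(w h²)⁻¹`; an integer outside it is at distance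
  -- at least half that frequency.
  have hS : ∀ n ∈ S, (2 * w * h ^ 2)⁻¹ ≤ |(n : ℝ) - (w * h ^ 2)⁻¹| := by
    intro n hn
    have hpos : 0 < (w * h ^ 2)⁻¹ := by positivity
    have e1 : (2 * w * h ^ 2)⁻¹ = (w * h ^ 2)⁻¹ / 2 := by field_simp
    have h3 : |(n : ℝ)| < (w * h ^ 2)⁻¹ / 2 ∨ 2 * (w * h ^ 2)⁻¹ < |(n : ℝ)| := by
      rcases not_and_or.1 hn with h | h
      · left
        rw [not_le, lt_div_iff₀ (by positivity)] at h
        rw [← e1, inv_eq_one_div, lt_div_iff₀ (by positivity)]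
        linarith
      · right
        rw [not_le, div_lt_iff₀ hw] at h
        rw [← div_eq_mul_inv, div_lt_iff₀ (by positivity)]
        linarith
    rw [e1, ← abs_of_pos hpos]
    have h4 := abs_abs_sub_abs_le (n : ℝ) ((w * h ^ 2)⁻¹)
    rw [abs_of_pos hpos] at h4 ⊢
    refine le_trans ?_ h4
    rcases h3 with h3 | h3
    · rw [abs_sub_comm]; exact le_trans (by linarith) (le_abs_self _)
    · exact le_trans (by linarith) (le_abs_self _)
  have h5 := hM (w * h ^ 2) (2 * w * h ^ 2) S (by positivity) hS
  have h6 : ∀ n : S, ∫⁻ x : Circ, ‖fourierCoeff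
      (fun y : Circ => quasimode χ γ w y₀ a h (x, y)) (n : ℤ)‖ₑ ^ 2
      = ENNReal.ofReal (√√Real.pi ^ 2) * ‖fourierCoeff G (n : ℤ)‖ₑ ^ 2 := by
    intro n
    have h7 : ∀ x : Circ, ‖fourierCoeff
        (fun y : Circ => quasimode χ γ w y₀ a h (x, y)) (n : ℤ)‖ₑ ^ 2
        = ‖F x‖ₑ ^ 2 * ‖fourierCoeff G (n : ℤ)‖ₑ ^ 2 := by
      intro x
      rw [← mul_pow, ← enorm_mul]
      congr 2
      exact fourierCoeff.const_mul G (F x) n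
    simp_rw [h7]
    rw [lintegral_mul_const' _ _ (by simp), hF]
  rw [yFreqMass]
  simp_rw [h6]
  rw [ENNReal.tsum_mul_left]
  calc _ ≤ ENNReal.ofReal (2 * Real.pi) * (ENNReal.ofReal (√√Real.pi ^ 2)
        * ENNReal.ofReal (M ^ 2 * (2 * w * h ^ 2) ^ (2 * N))) := by gcongr
    _ = ENNReal.ofReal (2 * Real.pi * (√√Real.pi ^ 2
        * (M ^ 2 * (2 * w * h ^ 2) ^ (2 * N)))) := by
      rw [← ENNReal.ofReal_mul (by positivity), ← ENNReal.ofReal_mul (by positivity)]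
    _ ≤ _ := by
      refine ENNReal.ofReal_le_ofReal ?_
      -- The decay is `h^{4N}`, more than is needed.
      have h8 : (h ^ 2) ^ (2 * N) ≤ h ^ N := by
        rw [← pow_mul]
        exact pow_le_pow_of_le_one hh.le h1 (by omega)
      rw [mul_pow (2 * w)]
      calc 2 * Real.pi * (√√Real.pi ^ 2 * (M ^ 2 * ((2 * w) ^ (2 * N) * (h ^ 2) ^ (2 * N))))
          ≤ 2 * Real.pi * (√√Real.pi ^ 2 * (M ^ 2 * ((2 * w) ^ (2 * N) * h ^ N))) := by gcongr
        _ = _ := by ring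

end quasimode

/-! ### The resolvent bound and the assembly -/

/-- A normalized quasimode bounds the resolvent from below. -/
lemma one_le_norm_resolvent_mul {V : Circ → ℝ} {b : Torus → ℝ} {h M : ℝ} {R : L2 →L[ℂ] L2}
    (hR : IsResolvent V b h R) {φ : Torus → ℂ} (hs : IsSmooth φ)
    (hn : eLpNorm φ 2 volume = 1) (hφ : AEStronglyMeasurable φ volume)
    (hP : AEStronglyMeasurable (dampedOp V b h φ) volume)
    (hle : eLpNorm (dampedOp V b h φ) 2 volume ≤ ENNReal.ofReal M) (hM : 0 ≤ M) :
    1 ≤ ‖R‖ * M := by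
  have hm : MemLp φ 2 volume := ⟨hφ, by rw [hn]; exact ENNReal.one_lt_top⟩
  have hm' : MemLp (dampedOp V b h φ) 2 volume := ⟨hP, hle.trans_lt ENNReal.ofReal_lt_top⟩
  have hmem : (hm.toLp, hm'.toLp) ∈ opGraph V b h := ⟨φ, hs, hm.coeFn_toLp, hm'.coeFn_toLp⟩
  have heq := (hR _ _).1 (subset_closure hmem)
  have h1 : ‖(hm.toLp : L2)‖ = 1 := by rw [Lp.norm_toLp, hn, ENNReal.toReal_one]
  have h2 : ‖(hm'.toLp : L2)‖ ≤ M := by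
    rw [Lp.norm_toLp]; exact ENNReal.toReal_le_of_le_ofReal hM hle
  calc (1 : ℝ) = ‖R hm'.toLp‖ := by rw [← heq, h1]
    _ ≤ ‖R‖ * ‖(hm'.toLp : L2)‖ := R.le_opNorm _
    _ ≤ ‖R‖ * M := by gcongr

end Grushin

theorem theorem5p1 (V : Grushin.Circ → ℝ) (hV : Grushin.IsPotential V)
    (b : Grushin.Torus → ℝ) (hb : Continuous b) (hb0 : ∀ p, 0 ≤ b p)
    (hsupp : tsupport b ∩ {p : Grushin.Torus | p.1 = 0} ≠ {p : Grushin.Torus | p.1 = 0}) :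
    (∃ ψ : ℝ → Grushin.Torus → ℂ,
      -- smooth, normalized in `L²`
      (∀ h ∈ Set.Ioc (0 : ℝ) 1, Grushin.IsSmooth (ψ h) ∧
        MeasureTheory.eLpNorm (ψ h) 2 MeasureTheory.volume = 1) ∧
      -- quasimodes of width `O(h²)`
      (∃ C : ℝ, ∀ h ∈ Set.Ioc (0 : ℝ) 1,
        MeasureTheory.eLpNorm (Grushin.dampedOp V b h (ψ h)) 2 MeasureTheory.volume
          ≤ ENNReal.ofReal (C * h ^ 2)) ∧
      -- not seen by the damping, up to `O(h^∞)`
      (∀ N : ℕ, ∃ C : ℝ, ∀ h ∈ Set.Ioc (0 : ℝ) 1,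
        MeasureTheory.eLpNorm (fun p => (Real.sqrt (b p) : ℂ) * ψ h p) 2 MeasureTheory.volume
          ≤ ENNReal.ofReal (C * h ^ N)) ∧
      -- subelliptic regime: the frequencies in `y` are of size `h⁻²`, up to `O(h^∞)`
      (∃ c₁ c₂ : ℝ, 0 < c₁ ∧ c₁ ≤ c₂ ∧ ∀ N : ℕ, ∃ C : ℝ, ∀ h ∈ Set.Ioc (0 : ℝ) 1,
        Grushin.yFreqMass (ψ h) {n : ℤ | ¬ (c₁ ≤ h ^ 2 * |(n : ℝ)| ∧ h ^ 2 * |(n : ℝ)| ≤ c₂)}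
          ≤ ENNReal.ofReal (C * h ^ N)) ∧
      -- the leading part is a Hermite ground state in `x`, carried by an arc of the line `x = 0`
      -- that does not meet the support of `b`
      (∃ (y₀ : ℝ) (a : ℝ → ℂ), ContDiff ℝ ∞ a ∧
        tsupport a ⊆ Set.Ioo (y₀ - Real.pi) (y₀ + Real.pi) ∧
        (∀ y ∈ tsupport a, ((0 : Grushin.Circ), (y : Grushin.Circ)) ∉ tsupport b) ∧
        ∃ C : ℝ, ∀ h ∈ Set.Ioc (0 : ℝ) 1,
          MeasureTheory.eLpNorm
            (fun q : ℝ × ℝ => ψ h ((q.1 : Grushin.Circ), (q.2 : Grushin.Circ)) -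
              Grushin.profile
                (Real.sqrt (iteratedDeriv 2 (fun x : ℝ => V (x : Grushin.Circ)) 0 / 2)) a h q) 2
            (MeasureTheory.volume.restrict
              (Set.Ioo (-Real.pi) Real.pi ×ˢ Set.Ioo (y₀ - Real.pi) (y₀ + Real.pi)))
            ≤ ENNReal.ofReal (C * h))) ∧
    -- lower bounds for the resolvents of both signs
    (∃ c : ℝ, 0 < c ∧ ∀ h ∈ Set.Ioc (0 : ℝ) 1, ∀ R : Grushin.L2 →L[ℂ] Grushin.L2,
      (Grushin.IsResolvent V b h R ∨ Grushin.IsResolvent V (fun p => -b p) h R) →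
        c * h⁻¹ ^ 2 ≤ ‖R‖) := by
  obtain ⟨y₀, δ, hδ, hδπ, hbox⟩ := Grushin.exists_box hsupp
  obtain ⟨χ, hχ⟩ : ∃ χ : ContDiffBump (0 : ℝ), χ.rOut = δ :=
    ⟨⟨δ / 2, δ, by positivity, by linarith⟩, rfl⟩
  have hχπ : χ.rOut < Real.pi := hχ.trans_lt hδπ
  obtain ⟨a, ha, haB, han⟩ := Grushin.exists_normalized_bump y₀ hδ
    (inv_pos.2 (Real.sqrt_pos.2 (Real.sqrt_pos.2 Real.pi_pos)))
  have haδ : ∀ y ∈ tsupport a, |y - y₀| ≤ δ := fun y hy => by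
    simpa [Real.dist_eq] using haB hy
  have has : tsupport a ⊆ Set.Ioo (y₀ - Real.pi) (y₀ + Real.pi) := fun y hy => by
    have := abs_le.1 (haδ y hy)
    constructor <;> linarith
  have hoff : ∀ x y : ℝ, |x| < χ.rOut → y ∈ tsupport a →
      ((x : Grushin.Circ), (y : Grushin.Circ)) ∉ tsupport b := fun x y hx hy =>
    hbox x y (hχ ▸ hx.le) (haδ y hy)
  have hoff' : ∀ x y : ℝ, |x| < χ.rOut → y ∈ tsupport a →
      ((x : Grushin.Circ), (y : Grushin.Circ)) ∉ tsupport (fun p => -b p) := fun x y hx hy =>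
    fun h => hoff x y hx hy (by
      rwa [tsupport, show Function.support (fun p => -b p) = Function.support b from
        Function.support_neg b] at h)
  obtain ⟨c, C, hC, hVb⟩ := Grushin.exists_potential_bounds hV
  set w := √(iteratedDeriv 2 (fun x : ℝ => V (x : Grushin.Circ)) 0 / 2) with hwdef
  have hw : 0 < w := Real.sqrt_pos.2 (by linarith [hV.deriv2_pos])
  obtain ⟨γ, hγ⟩ : ∃ γ, γ = c / w ^ 2 := ⟨_, rfl⟩
  set ψ := Grushin.quasimode χ γ w y₀ a with hψ
  have hsmooth : ∀ h, Grushin.IsSmooth (ψ h) := Grushin.isSmooth_quasimode γ w hχπ ha has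
  have hnorm : ∀ h ∈ Set.Ioc (0 : ℝ) 1, eLpNorm (ψ h) 2 volume = 1 := fun h hh =>
    Grushin.eLpNorm_quasimode γ w hχπ ha has han hh.1 hh.2
  have hzero : ∀ h p, ψ h p ≠ 0 → b p = 0 := fun h p hp =>
    Grushin.eq_zero_of_quasimode_ne_zero γ w hoff hp
  refine ⟨⟨ψ, fun h hh => ⟨hsmooth h, hnorm h hh⟩,
    Grushin.exists_eLpNorm_dampedOp_le hw hγ hC hVb hχπ ha has hoff, fun N => ⟨0, fun h _ => ?_⟩,
    ⟨1 / (2 * w), 2 / w, by positivity, ?_,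
      Grushin.exists_yFreqMass_quasimode_le γ hw hχπ ha has⟩,
    ⟨y₀, a, ha, has, fun y hy => by simpa using hoff 0 y (by simpa using χ.rOut_pos) hy,
      Grushin.exists_eLpNorm_quasimode_sub_profile_le γ ha han w y₀⟩⟩, ?_⟩
  · have h0 : (fun p => (√(b p) : ℂ) * ψ h p) = fun _ => 0 := by
      funext p
      by_cases hp : ψ h p = 0
      · rw [hp, mul_zero]
      · rw [hzero h p hp]; simp
    rw [h0]
    simp
  · rw [div_le_div_iff₀ (by positivity) hw]; linarith
  -- Only the support of the damping matters, so the same quasimodes serve `b` and `-b`.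
  · have hres : ∀ b' : Grushin.Torus → ℝ, (∀ x y : ℝ, |x| < χ.rOut → y ∈ tsupport a →
        ((x : Grushin.Circ), (y : Grushin.Circ)) ∉ tsupport b') → ∃ c : ℝ, 0 < c ∧
        ∀ h ∈ Set.Ioc (0 : ℝ) 1, ∀ R : Grushin.L2 →L[ℂ] Grushin.L2,
          Grushin.IsResolvent V b' h R → c * h⁻¹ ^ 2 ≤ ‖R‖ := by
      intro b' hb'
      obtain ⟨M, hM⟩ := Grushin.exists_eLpNorm_dampedOp_le hw hγ hC hVb hχπ ha has hb'
      -- The sign of `M` is unknown; `|M| + 1` is a positive replacement.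
      refine ⟨(|M| + 1)⁻¹, by positivity, fun h hh R hR => ?_⟩
      have hpos := hh.1
      have hf := Grushin.contDiff_xProfile (χ := χ) γ h
      have hfs := Grushin.tsupport_xProfile_subset γ hχπ h
      have hg := Grushin.contDiff_osc (w * h ^ 2) ha
      have hgs := (Grushin.tsupport_osc_subset (w * h ^ 2) a).trans has
      have hcont : Continuous (ψ h) :=
        ((Grushin.continuous_periodize hf hfs).comp continuous_fst).mul
          ((Grushin.continuous_periodize hg hgs).comp continuous_snd)
      have hPc := Grushin.continuous_dampedOp_tensor (b := b') (h := h)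
        (Grushin.continuous_of_isPotential hV) hf hfs hg hgs
        (fun p hp => Grushin.eq_zero_of_quasimode_ne_zero (p := p) γ w hb' hp)
      have h1 := Grushin.one_le_norm_resolvent_mul (M := (|M| + 1) * h ^ 2) hR (hsmooth h)
        (hnorm h hh) hcont.aestronglyMeasurable hPc.aestronglyMeasurable
        ((hM h hh).trans (ENNReal.ofReal_le_ofReal (by
          gcongr; exact (le_abs_self M).trans (by linarith)))) (by positivity)
      rw [inv_pow, ← mul_inv, inv_eq_one_div, div_le_iff₀ (by positivity)]
      exact h1
    obtain ⟨c₁, hc₁, h₁⟩ := hres b hoff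
    obtain ⟨c₂, hc₂, h₂⟩ := hres (fun p => -b p) hoff'
    refine ⟨min c₁ c₂, lt_min hc₁ hc₂, fun h hh R hR => ?_⟩
    have hnn : 0 ≤ h⁻¹ ^ 2 := sq_nonneg _
    rcases hR with hR | hR
    · exact (mul_le_mul_of_nonneg_right (min_le_left _ _) hnn).trans (h₁ h hh R hR)
    · exact (mul_le_mul_of_nonneg_right (min_le_right _ _) hnn).trans (h₂ h hh R hR)
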